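/- Conventions. Let $\partial_x$ be the total derivative on differential polynomials over $\mathbb C$ in $q,r$, and let $\partial_x^{-1}$ be its inverse on differential polynomials without constant term (all integrations below are exact). The AKNS flows are $$K_n=\begin{pmatrix}K_{1,n}\\K_{2,n}\end{pmatrix}=L^n\begin{pmatrix}-q\\ r\end{pmatrix},\qquad L=\begin{pmatrix}-\partial_x+2q\partial_x^{-1}r & 2q\partial_x^{-1}q\\ -2r\partial_x^{-1}r & \partial_x-2r\partial_x^{-1}q\end{pmatrix}.$$ For $\sigma_1,\sigma_2,\delta\in\{1,-1\}$ with $\sigma_1\sigma_2=1$, the (local or nonlocal) mKdV hierarchy is $$q_{t_{2l+1}}=K_{1,2l+1}\big|_{r(x,t)=\delta q(\sigma_1x,\sigma_2t)},\qquad l=0,1,2,\dots,$$ where $t_1=x$ and $t$ stands for $(t_3,t_5,\dots)$; the first nontrivial member is $q_{t_3}=q_{xxx}-6\delta\, q\,q_x\,q(\sigma_1x,\sigma_2t)$. The variables $x,t_3,t_5,\dots$ are complex (real variables are the special case of restriction), and are such that $\sum_{j\ge0}k^{2j+1}t_{2j+1}$ converges for every $k\in\mathbb C$ (for instance, only finitely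 many are nonzero). For an integer $n\ge0$ and functions $\varphi,\psi$ with values in $\mathbb C^{2(n+1)}$, $|\widehat\varphi^{(a)};\widehat\psi^{(b)}|$ with $a+b=2n$ is the determinant with the columns $\varphi,\partial_x\varphi,\dots,\partial_x^a\varphi,\psi,\partial_x\psi,\dots,\partial_x^b\psi$ (no column of $\varphi$ if $a=-1$). **Theorem.** Let $\sigma_1,\sigma_2,\delta\in\{1,-1\}$, $\sigma_1\sigma_2=1$, and $n\ge0$. (1) Let $A,T\in\mathbb C^{2(n+1)\times2(n+1)}$ and $C^\pm\in\mathbb C^{2(n+1)}$ satisfy $$AT+\sigma_1TA=0,\qquad T^2=\delta\sigma_1I,\qquad C^-=TC^+,$$ and put $$\varphi=\exp\Bigl(\tfrac12\sum_{j\ge0}A^{2j+1}t_{2j+1}\Bigr)C^+,\qquad \psi=\exp\Bigl(-\tfrac12\sum_{j\ge0}A^{2j+1}t_{2j+1}\Bigr)C^-.$$ Then $\psi(x,t)=T\varphi(\sigma_1x,\sigma_2t)$, and $$q=\frac{2|\widehat\varphi^{(n-1)};\widehat\psi^{(n+1)}|}{|\widehat\varphi^{(n)};\widehat\psi^{(n)}|}$$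 solves every equation of the mKdV hierarchy on the set where the denominator does not vanish; this set is invariant under $(x,t)\mapsto(\sigma_1x,\sigma_2t)$, and there $q$ and $\delta q(\sigma_1x,\sigma_2t)$ are analytic in $x$. (2) For every $\mathbf K\in\mathbb C^{(n+1)\times(n+1)}$, the matrix $A=\begin{pmatrix}\mathbf K&0\\0&-\mathbf K\end{pmatrix}$ and the following matrix $T$ (with blocks of size $n+1$) satisfy $AT+\sigma_1TA=0$ and $T^2=\delta\sigma_1I$: for $(\sigma_1,\delta)=(1,1)$, $T=\begin{pmatrix}0&I\\I&0\end{pmatrix}$; for $(1,-1)$, $T=\begin{pmatrix}0&-I\\I&0\end{pmatrix}$; for $(-1,1)$, $T=\begin{pmatrix}iI&0\\0&-iI\end{pmatrix}$; for $(-1,-1)$, $T=\begin{pmatrix}I&0\\0&-I\end{pmatrix}$. (3) Let $T$, $A$ be as in (2) and $\xi(k)=\frac12kx+\frac12\sum_{j\ge1}k^{2j+1}t_{2j+1}$. If $\mathbf K=\mathrm{Diag}(k_1,\dots,k_{n+1})$ and $C^+=(c_1,\dots,c_{n+1},d_1,\dots,d_{n+1})^T$, then $$\varphi=(c_1e^{\xi(k_1)},\dots,c_{n+1}e^{\xi(k_{n+1})},d_1e^{\xi(-k_1)},\dots,d_{n+1}e^{\xi(-k_{n+1})})^T.$$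 If $\mathbf K$ is the lower triangular $(n+1)\times(n+1)$ Jordan block with eigenvalue $k$, $c$ and $d$ are constants or, more generally, functions analytic at $k$, and $C^+=\bigl(c,\frac{\partial_kc}{1!},\dots,\frac{\partial_k^nc}{n!},d,\frac{\partial_kd}{1!},\dots,\frac{\partial_k^nd}{n!}\bigr)^T$, then $$\varphi=\Bigl(ce^{\xi(k)},\tfrac{\partial_k}{1!}(ce^{\xi(k)}),\dots,\tfrac{\partial_k^n}{n!}(ce^{\xi(k)}),de^{\xi(-k)},\tfrac{\partial_k}{1!}(de^{\xi(-k)}),\dots,\tfrac{\partial_k^n}{n!}(de^{\xi(-k)})\Bigr)^T.$$ With either of these explicit $\varphi$ and $\psi(x,t)=T\varphi(\sigma_1x,\sigma_2t)$, the function $q$ of (1) solves the mKdV hierarchy in the sense of (1). -/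

import Mathlib

namespace AKNS

noncomputable section

open MvPolynomial

/-! ### The AKNS hierarchy as a sequence of pairs of differential polynomials -/

/-- Differential polynomials over `ℂ` in two dependent variables `q` and `r`: the variable
`Sum.inl i` stands for `∂ₓⁱ q`, the variable `Sum.inr i` for `∂ₓⁱ r`. -/
abbrev DiffPoly : Type := MvPolynomial (ℕ ⊕ ℕ) ℂ

/-- The differential variable `∂ₓⁱ q`. -/
def qv (i : ℕ) : DiffPoly := X (Sum.inl i)

/-- The differential variable `∂ₓⁱ r`. -/
def rv (i : ℕ) : DiffPoly := X (Sum.inr i)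

/-- `∂ₓⁱ q ↦ ∂ₓⁱ⁺¹ q`, `∂ₓⁱ r ↦ ∂ₓⁱ⁺¹ r` on the set of variables. -/
def shift : ℕ ⊕ ℕ → ℕ ⊕ ℕ := Sum.map (· + 1) (· + 1)

/-- The total derivative `∂ₓ` on differential polynomials. -/
def D : Derivation ℂ DiffPoly DiffPoly := mkDerivation ℂ (fun v => X (shift v))

open scoped Classical in
/-- The formal integration `∂ₓ⁻¹`: the primitive without constant term. It is the two-sided inverse
of `∂ₓ` on differential polynomials without constant term, where `∂ₓ` is injective
(`dInv_D`, `D_dInv`). Off the range of `∂ₓ` it takes the value `0`, which is never used below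
(`akns_exact`). -/
def dInv (p : DiffPoly) : DiffPoly :=
  if h : ∃ w : DiffPoly, D w = p ∧ constantCoeff w = 0 then h.choose else 0

/-- The recursion operator
`L = ((-∂ₓ + 2q∂ₓ⁻¹r, 2q∂ₓ⁻¹q), (-2r∂ₓ⁻¹r, ∂ₓ - 2r∂ₓ⁻¹q))`. -/
def L (u : DiffPoly × DiffPoly) : DiffPoly × DiffPoly :=
  (-D u.1 + 2 * qv 0 * dInv (rv 0 * u.1 + qv 0 * u.2),
    D u.2 - 2 * rv 0 * dInv (rv 0 * u.1 + qv 0 * u.2))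

/-- The flows `K_n = Lⁿ (-q, r)` of the AKNS hierarchy. -/
def K (n : ℕ) : DiffPoly × DiffPoly := L^[n] (-qv 0, rv 0)

/-! ### The integrations in the recursion are well defined -/

lemma D_X (v : ℕ ⊕ ℕ) : D (X v) = X (shift v) := mkDerivation_X _ _ _

lemma shift_injective : Function.Injective shift := by
  rintro (a | a) (b | b) h <;> simp_all [shift]

lemma pderiv_shift_D (v : ℕ ⊕ ℕ) (p : DiffPoly) :
    pderiv (shift v) (D p) = D (pderiv (shift v) p) + pderiv v p := by
  have h : ⁅(pderiv (shift v) : Derivation ℂ DiffPoly DiffPoly), D⁆ = pderiv v := by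
    refine derivation_ext fun w => ?_
    rw [Derivation.commutator_apply, D_X, pderiv_X, pderiv_X, pderiv_X]
    by_cases hw : w = v
    · subst hw
      by_cases h' : w = shift w
      · exact absurd h' (by rcases w with w | w <;> simp [shift])
      · simp [h']
    · have h1 : shift w ≠ shift v := fun h => hw (shift_injective h)
      by_cases h2 : w = shift v
      · subst h2
        simp [h1, hw]
      · simp [h1, h2, hw]
  have := congrArg (fun d : Derivation ℂ DiffPoly DiffPoly => d p) h
  simp only [Derivation.commutator_apply] at this
  rw [← this]; ring

lemma constantCoeff_D (p : DiffPoly) : constantCoeff (D p) = 0 := by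
  induction p using MvPolynomial.induction_on with
  | C a => rw [derivation_C]; simp
  | add p q hp hq => simp [hp, hq]
  | mul_X p v hp => simp [Derivation.leibniz, D_X, hp]

lemma eq_zero_of_D_eq_zero {p : DiffPoly} (h : D p = 0) (h0 : constantCoeff p = 0) : p = 0 := by
  have step : ∀ v, pderiv (shift v) p = 0 → pderiv v p = 0 := by
    intro v hv
    have := pderiv_shift_D v p
    rw [h, hv] at this
    simpa using this.symm
  obtain ⟨N, hN⟩ : ∃ N : ℕ, ∀ v ∈ p.vars, Sum.elim id id v < N := by
    refine ⟨p.vars.sup (Sum.elim id id) + 1, fun v hv => Nat.lt_succ_of_le ?_⟩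
    exact Finset.le_sup (f := Sum.elim id id) hv
  have all : ∀ k v, N ≤ Sum.elim id id v + k → pderiv v p = 0 := by
    intro k
    induction k with
    | zero =>
      intro v hv
      exact pderiv_eq_zero_of_notMem_vars fun hm => by have := hN v hm; omega
    | succ k ih =>
      intro v hv
      refine step v (ih _ ?_)
      rcases v with v | v <;> simp [shift] at hv ⊢ <;> omega
  ext m
  rw [coeff_zero]
  by_cases hm : m = 0
  · subst hm; exact h0
  · obtain ⟨v, hv⟩ : ∃ v, m v ≠ 0 := by
      by_contra! hc
      exact hm (Finsupp.ext hc)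
    have h1 : coeff (m - Finsupp.single v 1) (pderiv v p) = 0 := by
      rw [all N v (by omega), coeff_zero]
    have h2 : m - Finsupp.single v 1 + Finsupp.single v 1 = m :=
      tsub_add_cancel_of_le (Finsupp.single_le_iff.mpr (Nat.one_le_iff_ne_zero.mpr hv))
    rw [coeff_pderiv, h2] at h1
    rcases mul_eq_zero.mp h1 with h1 | h1
    · exact h1
    · exact absurd h1 (Nat.cast_add_one_ne_zero _)

lemma dInv_D {w : DiffPoly} (h0 : constantCoeff w = 0) : dInv (D w) = w := by
  have h : ∃ w' : DiffPoly, D w' = D w ∧ constantCoeff w' = 0 := ⟨w, rfl, h0⟩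
  rw [dInv, dif_pos h]
  refine sub_eq_zero.mp (eq_zero_of_D_eq_zero ?_ ?_)
  · rw [map_sub, h.choose_spec.1, sub_self]
  · rw [map_sub, h.choose_spec.2, h0, sub_zero]

lemma D_dInv {p : DiffPoly} (h : ∃ w, D w = p) : D (dInv p) = p := by
  obtain ⟨w, rfl⟩ := h
  have h1 : D (w - C (constantCoeff w)) = D w := by rw [map_sub, derivation_C, sub_zero]
  rw [← h1, dInv_D (by simp)]

/-- Auxiliary sequence for `akns_exact`: the coefficients `(aₙ, bₙ, cₙ)` of the formal series `V` with
`V_x = [U, V]` and `-det V = 1`. -/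
def abc : ℕ → DiffPoly × DiffPoly × DiffPoly
  | 0 => (1, 0, 0)
  | n + 1 =>
    (-C (1 / 2) * ∑ i : Fin n,
        ((abc (i + 1)).1 * (abc (n - i)).1 + (abc (i + 1)).2.1 * (abc (n - i)).2.2),
      C (1 / 2) * D (abc n).2.1 + qv 0 * (abc n).1,
      -C (1 / 2) * D (abc n).2.2 + rv 0 * (abc n).1)
termination_by n => n
decreasing_by all_goals omega

lemma two_eq : (2 : DiffPoly) = C 2 := (map_ofNat C 2).symm

lemma pow_eq (n : ℕ) : ((-2) ^ n : DiffPoly) = C ((-2) ^ n) := by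
  rw [map_pow, map_neg, ← two_eq]

lemma D_C_mul (a : ℂ) (p : DiffPoly) : D (C a * p) = C a * D p := by
  rw [← smul_eq_C_mul, D.map_smul, smul_eq_C_mul]

lemma two_half : (2 : DiffPoly) * C (1 / 2) = 1 := by
  rw [two_eq, ← C_mul]; norm_num

lemma abc_zero : abc 0 = (1, 0, 0) := by rw [abc]

lemma two_a (n : ℕ) : 2 * (abc (n + 1)).1 = -∑ i : Fin n,
    ((abc (i + 1)).1 * (abc (n - i)).1 + (abc (i + 1)).2.1 * (abc (n - i)).2.2) := by
  rw [abc]; simp only; rw [← mul_assoc, mul_neg, two_half, neg_one_mul]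

lemma D_b (n : ℕ) : D (abc n).2.1 = 2 * (abc (n + 1)).2.1 - 2 * qv 0 * (abc n).1 := by
  rw [abc]; simp only; linear_combination (-D (abc n).2.1) * two_half

lemma D_c (n : ℕ) : D (abc n).2.2 = -2 * (abc (n + 1)).2.2 + 2 * rv 0 * (abc n).1 := by
  rw [abc]; simp only; linear_combination (-D (abc n).2.2) * two_half

lemma D_a (n : ℕ) : D (abc n).1 = qv 0 * (abc n).2.2 - rv 0 * (abc n).2.1 := by
  induction n using Nat.strong_induction_on with
  | _ n ih =>
  rcases n with _ | n
  · simp [abc_zero]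
  have two_ne : (2 : DiffPoly) ≠ 0 := two_ne_zero
  refine mul_left_cancel₀ two_ne ?_
  have h2 : (2 : DiffPoly) * D (abc (n + 1)).1 = D (2 * (abc (n + 1)).1) := by
    rw [two_eq, D_C_mul]
  rw [h2, two_a, map_neg, map_sum]
  have key : ∀ i ∈ Finset.range n, D ((abc (i + 1)).1 * (abc (n - i)).1
      + (abc (i + 1)).2.1 * (abc (n - i)).2.2)
      = (qv 0 * (abc (i + 1)).2.2 * (abc (n - i)).1 - qv 0 * (abc (i + 1)).1 * (abc (n - i)).2.2)
        + (rv 0 * (abc (i + 1)).2.1 * (abc (n - i)).1 - rv 0 * (abc (i + 1)).1 * (abc (n - i)).2.1)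
        + 2 * ((abc (i + 1 + 1)).2.1 * (abc (n + 1 - (i + 1))).2.2
          - (abc (i + 1)).2.1 * (abc (n + 1 - i)).2.2) := by
    intro i hi
    have hi' := Finset.mem_range.mp hi
    have e1 : n - i + 1 = n + 1 - i := by omega
    have e2 : n + 1 - (i + 1) = n - i := by omega
    rw [map_add, Derivation.leibniz, Derivation.leibniz, ih (i + 1) (by omega),
      ih (n - i) (by omega), D_b, D_c, e1, e2]
    simp only [smul_eq_mul]
    ring
  have refl1 : ∑ i ∈ Finset.range n, qv 0 * (abc (i + 1)).2.2 * (abc (n - i)).1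
      = ∑ i ∈ Finset.range n, qv 0 * (abc (i + 1)).1 * (abc (n - i)).2.2 := by
    rw [← Finset.sum_range_reflect]
    refine Finset.sum_congr rfl fun i hi => ?_
    have hi' := Finset.mem_range.mp hi
    rw [show n - 1 - i + 1 = n - i by omega, show n - (n - 1 - i) = i + 1 by omega]
    ring
  have refl2 : ∑ i ∈ Finset.range n, rv 0 * (abc (i + 1)).2.1 * (abc (n - i)).1
      = ∑ i ∈ Finset.range n, rv 0 * (abc (i + 1)).1 * (abc (n - i)).2.1 := by
    rw [← Finset.sum_range_reflect]
    refine Finset.sum_congr rfl fun i hi => ?_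
    have hi' := Finset.mem_range.mp hi
    rw [show n - 1 - i + 1 = n - i by omega, show n - (n - 1 - i) = i + 1 by omega]
    ring
  have hb : (abc 1).2.1 = qv 0 := by rw [abc, abc_zero]; simp
  have hc : (abc 1).2.2 = rv 0 := by rw [abc, abc_zero]; simp
  rw [Fin.sum_univ_eq_sum_range (fun i => D ((abc (i + 1)).1 * (abc (n - i)).1
      + (abc (i + 1)).2.1 * (abc (n - i)).2.2)), Finset.sum_congr rfl key,
    Finset.sum_add_distrib, Finset.sum_add_distrib, Finset.sum_sub_distrib,
    Finset.sum_sub_distrib, refl1, refl2, ← Finset.mul_sum,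
    Finset.sum_range_sub (fun i => (abc (i + 1)).2.1 * (abc (n + 1 - i)).2.2)]
  simp only [Nat.sub_zero, zero_add, Nat.add_sub_cancel_left, hb, hc]
  ring

lemma constantCoeff_bc (n : ℕ) :
    constantCoeff (abc n).2.1 = 0 ∧ constantCoeff (abc n).2.2 = 0 := by
  rcases n with _ | n
  · simp [abc_zero]
  · rw [abc]; simp [constantCoeff_D, qv, rv]

lemma constantCoeff_a (n : ℕ) : constantCoeff (abc (n + 1)).1 = 0 := by
  induction n using Nat.strong_induction_on with
  | _ n ih =>
  rw [abc]
  simp only [map_mul, map_neg, map_sum, map_add]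
  rw [Finset.sum_eq_zero, mul_zero]
  intro i _
  rw [ih i i.2, (constantCoeff_bc _).1]
  simp

lemma dInv_step (n : ℕ) :
    dInv (rv 0 * ((-2) ^ n * -(abc (n + 1)).2.1) + qv 0 * ((-2) ^ n * (abc (n + 1)).2.2))
      = (-2) ^ n * (abc (n + 1)).1 := by
  have h : D ((-2) ^ n * (abc (n + 1)).1) =
      rv 0 * ((-2) ^ n * -(abc (n + 1)).2.1) + qv 0 * ((-2) ^ n * (abc (n + 1)).2.2) := by
    rw [pow_eq, D_C_mul, D_a]
    ring
  rw [← h, dInv_D (by simp [constantCoeff_a])]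

lemma K_eq (n : ℕ) :
    K n = ((-2) ^ n * -(abc (n + 1)).2.1, (-2) ^ n * (abc (n + 1)).2.2) := by
  induction n with
  | zero => rw [abc, abc_zero]; simp [K]
  | succ n ih =>
    have hK : K (n + 1) = L (K n) := by rw [K, Function.iterate_succ_apply']; rfl
    have hD1 : D ((-2) ^ n * -(abc (n + 1)).2.1) = (-2) ^ n * -D (abc (n + 1)).2.1 := by
      rw [pow_eq, D_C_mul, map_neg]
    have hD2 : D ((-2) ^ n * (abc (n + 1)).2.2) = (-2) ^ n * D (abc (n + 1)).2.2 := by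
      rw [pow_eq, D_C_mul]
    rw [hK, ih, L]
    simp only [dInv_step, hD1, hD2, D_b, D_c]
    refine Prod.ext ?_ ?_ <;> simp only [pow_succ] <;> ring

/-- Each formal integration that occurs in `K_{n+1} = L K_n` is one of an exact differential
polynomial, so that `∂ₓ ∂ₓ⁻¹ = 1` there. -/
lemma akns_exact (n : ℕ) :
    D (dInv (rv 0 * (K n).1 + qv 0 * (K n).2)) = rv 0 * (K n).1 + qv 0 * (K n).2 := by
  refine D_dInv ⟨(-2) ^ n * (abc (n + 1)).1, ?_⟩
  rw [K_eq, pow_eq, D_C_mul, D_a]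
  ring

/-! ### Functions of the times and the mKdV hierarchy -/

/-- Time vectors: the entry `t j` is the time `t_{2j+1}`; in particular `t 0 = t₁ = x`. -/
abbrev Times : Type := ℕ → ℂ

/-- The time vectors for which `∑ⱼ k^{2j+1} t_{2j+1}` converges for every `k`
(in particular those with finitely many nonzero entries). -/
def Admissible (t : Times) : Prop := ∀ k : ℂ, Summable fun j => k ^ (2 * j + 1) * t j

/-- The map `(x, t) ↦ (σ₁ x, σ₂ t)`, where `t` stands for all the times `t₃, t₅, …`. -/
def reflect (σ₁ σ₂ : ℂ) (t : Times) : Times := fun j => if j = 0 then σ₁ * t 0 else σ₂ * t j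

/-- The restriction of a function of the times to the line through `t` in the direction of
`t_{2l+1}`. -/
def line {E : Type*} (u : Times → E) (t : Times) (l : ℕ) : ℂ → E :=
  fun s => u (Function.update t l s)

/-- The value at `t` of `∂ₓⁱ u`. -/
def dx (i : ℕ) (u : Times → ℂ) (t : Times) : ℂ := iteratedDeriv i (line u t 0) (t 0)

/-- The value at `t` of the differential polynomial `p` on the functions `q`, `r`. -/
def evalAt (p : DiffPoly) (q r : Times → ℂ) (t : Times) : ℂ :=
  aeval (Sum.elim (fun i => dx i q t) (fun i => dx i r t)) p

/-- `q` solves the local or nonlocal mKdV hierarchy `q_{t_{2l+1}} = K_{1,2l+1}`, `l = 0, 1, 2, …`,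
with `r(x,t) = δ q(σ₁ x, σ₂ t)`, on the set `Ω` of times. The set has to be mapped to itself by
`(x, t) ↦ (σ₁ x, σ₂ t)`, and `q` and `r` have to be analytic in `x`. -/
def SolvesMKdV (σ₁ σ₂ δ : ℂ) (q : Times → ℂ) (Ω : Set Times) : Prop :=
  ∀ t ∈ Ω, reflect σ₁ σ₂ t ∈ Ω ∧
    AnalyticAt ℂ (line q t 0) (t 0) ∧
    AnalyticAt ℂ (line (fun s => δ * q (reflect σ₁ σ₂ s)) t 0) (t 0) ∧
    ∀ l : ℕ, HasDerivAt (line q t l)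
      (evalAt (K (2 * l + 1)).1 q (fun s => δ * q (reflect σ₁ σ₂ s)) t) (t l)

/-! ### Double Wronskians -/

/-- The double Wronskian `|φ, ∂ₓφ, …, ∂ₓᵃ⁻¹φ; ψ, ∂ₓψ, …, ∂ₓᴺ⁻ᵃ⁻¹ψ|` with `a` columns from `φ` and
`N - a` columns from `ψ`. -/
def doubleWronskian {N : ℕ} (a : ℕ) (φ ψ : Times → Fin N → ℂ) (t : Times) : ℂ :=
  Matrix.det (Matrix.of fun i j : Fin N =>
    if (j : ℕ) < a then dx j (fun s => φ s i) t else dx (j - a) (fun s => ψ s i) t)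

/-- `f = |φ̂⁽ⁿ⁾; ψ̂⁽ⁿ⁾|`, of size `2(n+1)`. -/
def wf (n : ℕ) (φ ψ : Times → Fin (n + 1 + (n + 1)) → ℂ) : Times → ℂ :=
  doubleWronskian (n + 1) φ ψ

/-- `q = 2 |φ̂⁽ⁿ⁻¹⁾; ψ̂⁽ⁿ⁺¹⁾| / |φ̂⁽ⁿ⁾; ψ̂⁽ⁿ⁾|`. -/
def qsol (n : ℕ) (φ ψ : Times → Fin (n + 1 + (n + 1)) → ℂ) : Times → ℂ :=
  fun t => 2 * doubleWronskian n φ ψ t / wf n φ ψ t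

/-- The set of times where `f` does not vanish. -/
def regular (n : ℕ) (φ ψ : Times → Fin (n + 1 + (n + 1)) → ℂ) : Set Times :=
  {t | Admissible t ∧ wf n φ ψ t ≠ 0}

/-- The matrix `½ ∑ⱼ A^{2j+1} t_{2j+1}`. -/
def phase {N : ℕ} (A : Matrix (Fin N) (Fin N) ℂ) (t : Times) : Matrix (Fin N) (Fin N) ℂ :=
  (1 / 2 : ℂ) • ∑' j, t j • A ^ (2 * j + 1)

/-- `φ = exp(½ ∑ⱼ A^{2j+1} t_{2j+1}) C⁺`. -/
def phi {N : ℕ} (A : Matrix (Fin N) (Fin N) ℂ) (Cp : Fin N → ℂ) (t : Times) : Fin N → ℂ :=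
  (NormedSpace.exp (phase A t)).mulVec Cp

/-- `ψ = exp(-½ ∑ⱼ A^{2j+1} t_{2j+1}) C⁻`. -/
def psi {N : ℕ} (A : Matrix (Fin N) (Fin N) ℂ) (Cm : Fin N → ℂ) (t : Times) : Fin N → ℂ :=
  (NormedSpace.exp (-phase A t)).mulVec Cm

/-! ### Explicit forms -/

/-- The block matrix `((M₁, M₂), (M₃, M₄))`. -/
def block {m : ℕ} (M₁ M₂ M₃ M₄ : Matrix (Fin m) (Fin m) ℂ) : Matrix (Fin (m + m)) (Fin (m + m)) ℂ :=
  Matrix.reindex finSumFinEquiv finSumFinEquiv (Matrix.fromBlocks M₁ M₂ M₃ M₄)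

/-- The matrix `T` that is listed for `σ₁ = σ₂ = σ` and `δ`. -/
def IsTableT (σ δ : ℂ) {m : ℕ} (T : Matrix (Fin (m + m)) (Fin (m + m)) ℂ) : Prop :=
  (σ = 1 ∧ δ = 1 ∧ T = block 0 1 1 0) ∨
  (σ = 1 ∧ δ = -1 ∧ T = block 0 (-1) 1 0) ∨
  (σ = -1 ∧ δ = 1 ∧ T = block (Complex.I • 1) 0 0 (-(Complex.I • 1))) ∨
  (σ = -1 ∧ δ = -1 ∧ T = block 1 0 0 (-1))

/-- `A = diag(M, -M)`. -/
def tableA {m : ℕ} (M : Matrix (Fin m) (Fin m) ℂ) : Matrix (Fin (m + m)) (Fin (m + m)) ℂ :=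
  block M 0 0 (-M)

/-- `ξ(k) = ½ k x + ½ ∑_{j ≥ 1} k^{2j+1} t_{2j+1}`. -/
def xi (k : ℂ) (t : Times) : ℂ :=
  1 / 2 * k * t 0 + 1 / 2 * ∑' j, k ^ (2 * (j + 1) + 1) * t (j + 1)

/-- The lower triangular Jordan block with eigenvalue `k`. -/
def jordan (m : ℕ) (k : ℂ) : Matrix (Fin m) (Fin m) ℂ :=
  Matrix.of fun i j => if i = j then k else if (i : ℕ) = j + 1 then 1 else 0

/-- `(c₁ e^{ξ(k₁)}, …, c_m e^{ξ(k_m)}, d₁ e^{ξ(-k₁)}, …, d_m e^{ξ(-k_m)})ᵀ`. -/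
def phiDiag {m : ℕ} (k c d : Fin m → ℂ) (t : Times) : Fin (m + m) → ℂ :=
  Fin.append (fun i => c i * Complex.exp (xi (k i) t)) (fun i => d i * Complex.exp (xi (-k i) t))

/-- The vector `(g, ∂ₖ g / 1!, …, ∂ₖᵐ⁻¹ g / (m-1)!)ᵀ` at `k`. -/
def taylorVec (m : ℕ) (g : ℂ → ℂ) (k : ℂ) : Fin m → ℂ :=
  fun i => iteratedDeriv i g k / (Nat.factorial i : ℂ)

/-- `(c e^{ξ(k)}, …, ∂ₖᵐ⁻¹(c e^{ξ(k)}) / (m-1)!, d e^{ξ(-k)}, …, ∂ₖᵐ⁻¹(d e^{ξ(-k)}) / (m-1)!)ᵀ`, where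
`c` and `d` may depend on `k`. -/
def phiJordan (m : ℕ) (k : ℂ) (c d : ℂ → ℂ) (t : Times) : Fin (m + m) → ℂ :=
  Fin.append (taylorVec m (fun z => c z * Complex.exp (xi z t)) k)
    (taylorVec m (fun z => d z * Complex.exp (xi (-z) t)) k)

end

end AKNS

namespace AKNS

noncomputable section

open Matrix PowerSeries Filter Function Topology

/-! ### Exponentials, phases and lines of times -/

section phases

variable {N m : ℕ}

/-! The proof is a Darboux dressing of the zero solution of AKNS, with a spectral parameter `λ` and
series in `X = 1/λ`. Put `B = -A/2` and let `Z` have the columns `ψ` and `-φ`; every flow is then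
`Z' = c Bᵐ Z σ₃` with `m = 2l+1`, `c = 4ˡ`. The Darboux matrix `P = 1 + P₁X + … + P_{n+1}X^{n+1}` is
required to satisfy `∑ B^{n+1-k} Z P_kᵀ = 0`; for diagonalizable `B` this says that `λ^{n+1}P`
annihilates prescribed vectors at the eigenvalues. It is a linear system for the rows of `P` whose
determinant is the double Wronskian `f`, and Cramer's rule gives `q = -2(P₁)₀₁`
(`coeff_one_darboux`, `qsol_eq`).

Where `f ≠ 0`, the homogeneous system has only the zero solution. This uniqueness gives both main
facts.

Evolution: let `V = Pσ₃P⁻¹`. Differentiating the system and removing the polynomial part of `λᵐV`,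
which respects the condition, leaves a solution of the homogeneous system, so `P' = -c(λᵐV)₋P`
(`evolution_of_wsum_eq_zero`). For the `x`-flow this yields `V' = [λσ₃ + V₁, V]`. Together with `V²
= 1` it determines all coefficients of `V` as the differential polynomials `abc` in the entries of
`V₁ = ((0, q), (r, 0))` (`ev_abc`). The `X`-coefficient of `P'` along `t_{2l+1}` is `-4ˡV_{2l+2}`,
and `K_eq` identifies its upper right entry, up to the factor `-2`, with `K_{1,2l+1}`.

Reduction: `T` intertwines the data at `t` and at the reflected times while exchanging `φ` and `ψ`,
so by uniqueness `P(t)` is a conjugate of `P` at the reflected times with `λ` replaced by `-σλ`.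
Comparing the coefficients of `X` gives `r = δq(σx, σt)` (`wsum_twist_eq_zero`,
`coeff_eq_coeff_darboux`).

The explicit vectors come from functional calculus: a Jordan block acts on Taylor vectors as
multiplication by the variable, hence its phase and exponential act as multiplication by `ξ` and
`e^ξ` (`taylorVec_exp_mul`). -/

lemma admissible_update {t : Times} (ht : Admissible t) (l : ℕ) (s : ℂ) :
    Admissible (update t l s) := by
  intro k
  have h : (fun j => k ^ (2 * j + 1) * update t l s j)
      = update (fun j => k ^ (2 * j + 1) * t j) l (k ^ (2 * l + 1) * s) := by
    funext j
    by_cases hj : j = l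
    · subst hj; simp
    · simp [hj]
  rw [h]
  exact (ht k).update l _

lemma admissible_reflect {t : Times} (ht : Admissible t) (σ : ℂ) : Admissible (reflect σ σ t) := by
  intro k
  have h : (fun j => k ^ (2 * j + 1) * reflect σ σ t j)
      = fun j => σ * (k ^ (2 * j + 1) * t j) := by
    funext j
    by_cases hj : j = 0
    · subst hj; simp [reflect]; ring
    · simp [reflect, hj]; ring
  rw [h]
  exact (ht k).mul_left _

lemma summable_phase (A : Matrix (Fin N) (Fin N) ℂ) {t : Times} (ht : Admissible t) :
    Summable fun j => t j • A ^ (2 * j + 1) := by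
  let _ : NormedRing (Matrix (Fin N) (Fin N) ℂ) := Matrix.linftyOpNormedRing
  let _ : NormedAlgebra ℂ (Matrix (Fin N) (Fin N) ℂ) := Matrix.linftyOpNormedAlgebra
  -- Convergence at the single value `k = ‖A‖` already majorizes the matrix series.
  have h := (ht (‖A‖ : ℂ)).norm
  refine Summable.of_norm_bounded h fun j => ?_
  refine (norm_smul_le _ _).trans ?_
  rw [norm_mul (_ ^ _), norm_pow (_ : ℂ), Complex.norm_real, norm_norm, mul_comm]
  exact mul_le_mul_of_nonneg_right (norm_pow_le' A (Nat.succ_pos _)) (norm_nonneg _)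

/-- An intertwiner passes through each power, hence through the exponential series. It may be
rectangular, which serves both the square matrix `T` and the inclusions of the diagonal blocks. -/
lemma exp_mul_eq_mul_exp {X : Matrix (Fin N) (Fin N) ℂ} {X' : Matrix (Fin m) (Fin m) ℂ}
    {Y : Matrix (Fin N) (Fin m) ℂ} (h : X * Y = Y * X') :
    NormedSpace.exp X * Y = Y * NormedSpace.exp X' := by
  let _ : NormedRing (Matrix (Fin N) (Fin N) ℂ) := Matrix.linftyOpNormedRing
  let _ : NormedAlgebra ℂ (Matrix (Fin N) (Fin N) ℂ) := Matrix.linftyOpNormedAlgebra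
  let _ : NormedRing (Matrix (Fin m) (Fin m) ℂ) := Matrix.linftyOpNormedRing
  let _ : NormedAlgebra ℂ (Matrix (Fin m) (Fin m) ℂ) := Matrix.linftyOpNormedAlgebra
  have h1 := NormedSpace.exp_series_hasSum_exp' (𝕂 := ℂ) X
  have h2 := NormedSpace.exp_series_hasSum_exp' (𝕂 := ℂ) X'
  have h3 := h1.map (Matrix.addMonoidHomMulRight (l := Fin N) Y)
    (continuous_id.matrix_mul continuous_const)
  have h4 := h2.map (Matrix.addMonoidHomMulLeft (n := Fin m) Y)
    (continuous_const.matrix_mul continuous_id)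
  refine h3.unique ?_
  convert! h4 using 1
  funext k
  have hp : X ^ k * Y = Y * X' ^ k := by
    induction k with
    | zero => simp
    | succ k ih => rw [pow_succ, Matrix.mul_assoc, h, ← Matrix.mul_assoc, ih, Matrix.mul_assoc,
        ← pow_succ]
  simp [Matrix.addMonoidHomMulRight, Matrix.addMonoidHomMulLeft, hp]

lemma phase_mul_eq_mul_phase {A : Matrix (Fin N) (Fin N) ℂ} {A' : Matrix (Fin m) (Fin m) ℂ}
    {Y : Matrix (Fin N) (Fin m) ℂ} {t t' : Times} (ht : Admissible t) (ht' : Admissible t')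
    (h : ∀ j, (t j • A ^ (2 * j + 1)) * Y = Y * (t' j • A' ^ (2 * j + 1))) :
    phase A t * Y = Y * phase A' t' := by
  have h3 := (summable_phase A ht).hasSum.map (Matrix.addMonoidHomMulRight (l := Fin N) Y)
    (continuous_id.matrix_mul continuous_const)
  have h4 := (summable_phase A' ht').hasSum.map (Matrix.addMonoidHomMulLeft (n := Fin m) Y)
    (continuous_const.matrix_mul continuous_id)
  rw [phase, phase, Matrix.smul_mul, Matrix.mul_smul]
  congr 1
  refine h3.unique ?_
  convert! h4 using 1
  funext k
  exact h k

lemma phase_neg (A : Matrix (Fin N) (Fin N) ℂ) (t : Times) : phase (-A) t = -phase A t := by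
  have h : (fun j => t j • (-A) ^ (2 * j + 1)) = fun j => -(t j • A ^ (2 * j + 1)) := by
    funext j
    rw [Odd.neg_pow ⟨j, rfl⟩, smul_neg]
  rw [phase, phase, h, tsum_neg, smul_neg]

/-- Only odd powers of `A` enter the phase, so its sign can be moved to `A`; facts about `φ` then
cover `ψ`. -/
lemma psi_eq_phi (A : Matrix (Fin N) (Fin N) ℂ) (C : Fin N → ℂ) : psi A C = phi (-A) C := by
  funext t
  rw [psi, phi, phase_neg]

lemma phase_update (A : Matrix (Fin N) (Fin N) ℂ) {t : Times} (ht : Admissible t) (l : ℕ) (s : ℂ) :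
    phase A (update t l s) = (s - t l) • ((1 / 2 : ℂ) • A ^ (2 * l + 1)) + phase A t := by
  have h : (fun j => update t l s j • A ^ (2 * j + 1))
      = fun j => Pi.single (M := fun _ => Matrix (Fin N) (Fin N) ℂ) l
        ((s - t l) • A ^ (2 * l + 1)) j + t j • A ^ (2 * j + 1) := by
    funext j
    by_cases hj : j = l
    · subst hj; simp [sub_smul]
    · simp [hj]
  have hs : HasSum (Pi.single (M := fun _ => Matrix (Fin N) (Fin N) ℂ) l
      ((s - t l) • A ^ (2 * l + 1))) ((s - t l) • A ^ (2 * l + 1)) := hasSum_pi_single l _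
  rw [phase, phase, h, (hs.add (summable_phase A ht).hasSum).tsum_eq, smul_add,
    smul_comm (1 / 2 : ℂ)]

lemma commute_pow_phase (A : Matrix (Fin N) (Fin N) ℂ) {t : Times} (ht : Admissible t) (k : ℕ) :
    Commute (A ^ k) (phase A t) := by
  refine (phase_mul_eq_mul_phase ht ht fun j => ?_).symm
  rw [Matrix.smul_mul, Matrix.mul_smul, ← pow_add, ← pow_add, add_comm]

lemma phi_update (A : Matrix (Fin N) (Fin N) ℂ) (C : Fin N → ℂ) {t : Times} (ht : Admissible t)
    (l : ℕ) (s : ℂ) : phi A C (update t l s)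
      = NormedSpace.exp ((s - t l) • ((1 / 2 : ℂ) • A ^ (2 * l + 1))) *ᵥ phi A C t := by
  rw [phi, phi, phase_update A ht, Matrix.exp_add_of_commute, Matrix.mulVec_mulVec]
  exact ((commute_pow_phase A ht _).smul_left _).smul_left _

lemma hasDerivAt_exp_entry (X : Matrix (Fin N) (Fin N) ℂ) (s : ℂ) (i j : Fin N) :
    HasDerivAt (fun z : ℂ => NormedSpace.exp (z • X) i j) ((X * NormedSpace.exp (s • X)) i j) s := by
  let _ : NormedRing (Matrix (Fin N) (Fin N) ℂ) := Matrix.linftyOpNormedRing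
  let _ : NormedAlgebra ℂ (Matrix (Fin N) (Fin N) ℂ) := Matrix.linftyOpNormedAlgebra
  have h := hasDerivAt_exp_smul_const' (𝕂 := ℂ) X s
  exact ((ContinuousLinearMap.proj (R := ℂ) (φ := fun _ : Fin N => ℂ) j).comp
    (ContinuousLinearMap.proj (R := ℂ) (φ := fun _ : Fin N => Fin N → ℂ) i)).hasFDerivAt.comp_hasDerivAt
      s h

lemma hasDerivAt_phi (A : Matrix (Fin N) (Fin N) ℂ) (C : Fin N → ℂ) {t : Times}
    (ht : Admissible t) (l : ℕ) (s : ℂ) (i : Fin N) :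
    HasDerivAt (fun z => phi A C (update t l z) i)
      ((((1 / 2 : ℂ) • A ^ (2 * l + 1)) *ᵥ phi A C (update t l s)) i) s := by
  simp only [phi_update A C ht, Matrix.mulVec_mulVec]
  simp only [Matrix.mulVec, dotProduct]
  refine HasDerivAt.fun_sum fun j _ => ?_
  refine HasDerivAt.mul_const ?_ _
  have h := hasDerivAt_exp_entry ((1 / 2 : ℂ) • A ^ (2 * l + 1)) (s - t l) i j
  exact HasDerivAt.comp_sub_const s (t l) h

/-- Each `x`-derivative is a multiplication by `A/2`, so the columns of the double Wronskians are
Krylov vectors. -/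
lemma dx_phi (A : Matrix (Fin N) (Fin N) ℂ) (C : Fin N → ℂ) {t : Times}
    (ht : Admissible t) (j : ℕ) (i : Fin N) :
    dx j (fun s => phi A C s i) t = (((1 / 2 : ℂ) • A) ^ j *ᵥ phi A C t) i := by
  have h : ∀ j : ℕ, iteratedDeriv j (line (fun s => phi A C s i) t 0)
      = fun z => (((1 / 2 : ℂ) • A) ^ j *ᵥ phi A C (update t 0 z)) i := by
    intro j
    induction j with
    | zero => funext z; simp [line]
    | succ j ih =>
      funext z
      rw [iteratedDeriv_succ, ih]
      refine HasDerivAt.deriv ?_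
      rw [pow_succ, ← Matrix.mulVec_mulVec]
      simp only [Matrix.mulVec, dotProduct]
      refine HasDerivAt.fun_sum fun k _ => ?_
      refine HasDerivAt.const_mul _ ?_
      have := hasDerivAt_phi A C ht 0 z k
      simpa [Matrix.mulVec, dotProduct] using this
  simp only [dx, h, update_eq_self]

end phases

/-! ### Series in the inverse spectral parameter -/

/-- The ring of complex `2 × 2` matrices. -/
abbrev M2 : Type := Matrix (Fin 2) (Fin 2) ℂ

/-- The Pauli matrix `diag(1, -1)`. -/
def sigma3 : M2 := !![1, 0; 0, -1]

lemma sigma3_transpose : sigma3ᵀ = sigma3 := by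
  ext i j; fin_cases i <;> fin_cases j <;> simp [sigma3]

lemma sigma3_mul_self : sigma3 * sigma3 = 1 := by
  ext i j; fin_cases i <;> fin_cases j <;> simp [sigma3]

/-! ### Kernel conditions: matrix polynomials in `λ` evaluated at a matrix. -/

section evaluation

variable {N : ℕ}

/-- The weighted sum `∑_{k ≤ d} B^{d-k} Z F_kᵀ`: the value at `B` of the polynomial
`λ^d F(1/λ)`, applied to the columns of `Z`. -/
def wsum (B : Matrix (Fin N) (Fin N) ℂ) (Z : Matrix (Fin N) (Fin 2) ℂ) (d : ℕ) (F : M2⟦X⟧) :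
    Matrix (Fin N) (Fin 2) ℂ :=
  ∑ k ∈ Finset.range (d + 1), B ^ (d - k) * Z * (coeff k F)ᵀ

variable (B : Matrix (Fin N) (Fin N) ℂ) (Z : Matrix (Fin N) (Fin 2) ℂ)

lemma wsum_add (d : ℕ) (F G : M2⟦X⟧) : wsum B Z d (F + G) = wsum B Z d F + wsum B Z d G := by
  simp [wsum, Matrix.mul_add, Finset.sum_add_distrib]

lemma wsum_neg (d : ℕ) (F : M2⟦X⟧) : wsum B Z d (-F) = -wsum B Z d F := by
  simp [wsum]

lemma wsum_sub (d : ℕ) (F G : M2⟦X⟧) : wsum B Z d (F - G) = wsum B Z d F - wsum B Z d G := by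
  rw [sub_eq_add_neg, wsum_add, wsum_neg, ← sub_eq_add_neg]

lemma wsum_sum {ι : Type*} (s : Finset ι) (d : ℕ) (F : ι → M2⟦X⟧) :
    wsum B Z d (∑ i ∈ s, F i) = ∑ i ∈ s, wsum B Z d (F i) := by
  simp only [wsum, map_sum, Matrix.transpose_sum, Matrix.mul_sum]
  exact Finset.sum_comm

lemma wsum_C_mul (d : ℕ) (M : M2) (F : M2⟦X⟧) :
    wsum B Z d (C M * F) = wsum B Z d F * Mᵀ := by
  simp [wsum, Matrix.mul_assoc, Matrix.sum_mul]

lemma wsum_succ (d : ℕ) (F : M2⟦X⟧) :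
    wsum B Z (d + 1) F = B * wsum B Z d F + Z * (coeff (d + 1) F)ᵀ := by
  rw [wsum, Finset.sum_range_succ, wsum, Matrix.mul_sum]
  congr 1
  · refine Finset.sum_congr rfl fun k hk => ?_
    have := Finset.mem_range.mp hk
    rw [show d + 1 - k = d - k + 1 by omega, pow_succ']
    simp only [Matrix.mul_assoc]
  · simp

lemma wsum_X_mul (d : ℕ) (F : M2⟦X⟧) : wsum B Z (d + 1) (X * F) = wsum B Z d F := by
  rw [wsum, Finset.sum_range_succ', wsum]
  simp [coeff_succ_X_mul]

lemma wsum_X_pow_mul (d k : ℕ) (F : M2⟦X⟧) : wsum B Z (d + k) (X ^ k * F) = wsum B Z d F := by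
  induction k with
  | zero => simp
  | succ k ih => rw [pow_succ', mul_assoc, ← add_assoc, wsum_X_mul, ih]

/-- Past the degree of `F`, raising the weight only multiplies `λ^d F(1/λ)` by further powers of
`λ`, that is, by `B` on the left. -/
lemma wsum_add_of_degree_le {d : ℕ} {F : M2⟦X⟧} (hF : ∀ k, d < k → coeff k F = 0) (e : ℕ) :
    wsum B Z (d + e) F = B ^ e * wsum B Z d F := by
  induction e with
  | zero => simp
  | succ e ih =>
    rw [← add_assoc, wsum_succ, ih, hF _ (by omega), pow_succ', Matrix.mul_assoc]
    simp

/-- The part of degree at most `m` of a power series. -/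
def truncLE (m : ℕ) (V : M2⟦X⟧) : M2⟦X⟧ :=
  ∑ k ∈ Finset.range (m + 1), C (coeff k V) * X ^ k

/-- The power series `∑_k V_{k+m} X^k`. -/
def tail (m : ℕ) (V : M2⟦X⟧) : M2⟦X⟧ := PowerSeries.mk fun k => coeff (k + m) V

lemma coeff_truncLE (m k : ℕ) (V : M2⟦X⟧) :
    coeff k (truncLE m V) = if k ≤ m then coeff k V else 0 := by
  simp only [truncLE, map_sum, coeff_C_mul, coeff_X_pow, mul_ite, mul_one, mul_zero]
  rw [Finset.sum_ite_eq]
  simp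

lemma eq_truncLE_add_tail (m : ℕ) (V : M2⟦X⟧) :
    V = truncLE m V + X ^ (m + 1) * tail (m + 1) V := by
  ext1 k
  rw [map_add, coeff_truncLE, coeff_X_pow_mul']
  by_cases h : k ≤ m
  · simp [h, show ¬ m + 1 ≤ k by omega]
  · simp [h, show m + 1 ≤ k by omega, tail]

/-- Left multiplication by a polynomial in `λ` preserves the kernel condition: each monomial
contributes a power of `B` on the left and a constant matrix on the right of `wsum B Z d F`. -/
lemma wsum_truncLE_mul {d : ℕ} {F : M2⟦X⟧} (hF : ∀ k, d < k → coeff k F = 0)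
    (h0 : wsum B Z d F = 0) (m : ℕ) (V : M2⟦X⟧) : wsum B Z (d + m) (truncLE m V * F) = 0 := by
  rw [truncLE, Finset.sum_mul, wsum_sum]
  refine Finset.sum_eq_zero fun k hk => ?_
  have := Finset.mem_range.mp hk
  rw [mul_assoc, wsum_C_mul, show d + m = d + (m - k) + k by omega, wsum_X_pow_mul,
    wsum_add_of_degree_le B Z hF, h0]
  simp

lemma coeff_truncLE_mul_eq_zero {d : ℕ} {F : M2⟦X⟧} (hF : ∀ k, d < k → coeff k F = 0)
    (m : ℕ) (V : M2⟦X⟧) {k : ℕ} (hk : d + m < k) : coeff k (truncLE m V * F) = 0 := by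
  rw [coeff_mul]
  refine Finset.sum_eq_zero fun p hp => ?_
  have := Finset.HasAntidiagonal.mem_antidiagonal.mp hp
  rw [coeff_truncLE]
  by_cases h : p.1 ≤ m
  · rw [hF p.2 (by omega), mul_zero]
  · rw [if_neg h, zero_mul]

variable {B Z}

/-- The evolution equation of the Darboux matrix `P`: any derivation of `P` that comes from
`Z' = c Bᵐ Z σ₃` is given by the negative part of `λᵐ P σ₃ P⁻¹`. -/
theorem evolution_of_wsum_eq_zero {n m : ℕ} {c : ℂ} {P P' V : M2⟦X⟧}
    (hinj : ∀ S : M2⟦X⟧, wsum B Z n S = 0 → ∀ k ≤ n, coeff k S = 0)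
    (hdeg : ∀ k, n + 1 < k → coeff k P = 0) (hP : wsum B Z (n + 1) P = 0)
    (hP'0 : coeff 0 P' = 0) (hdeg' : ∀ k, n + 1 < k → coeff k P' = 0)
    (hder : wsum B Z (n + 1) P' + c • (B ^ m * wsum B Z (n + 1) (P * C sigma3)) = 0)
    (hV : V * P = P * C sigma3) :
    P' = -(C (c • (1 : M2)) * (X * (tail (m + 1) V * P))) := by
  set c' : M2⟦X⟧ := C (c • (1 : M2)) with hc'
  -- `X * S` is the defect of the claimed identity; it has no constant term because `P'` has none.
  -- It remains to show that `S` solves the homogeneous system and has degree at most `n`.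
  obtain ⟨S, hS⟩ : ∃ S, P' + c' * (X * (tail (m + 1) V * P)) = X * S := by
    refine X_dvd_iff.mpr ?_
    rw [← coeff_zero_eq_constantCoeff_apply, map_add, hP'0, coeff_C_mul, coeff_zero_X_mul]
    simp
  have hXc : X ^ m * c' = c' * X ^ m := ((commute_X_pow c' m)).symm.eq
  -- Since `VP = Pσ₃`, the negative part of `λᵐV` times `P` is `λᵐPσ₃` minus its polynomial part
  -- times `P`. The right side thus involves only polynomials, which bounds the degree of `S`.
  have hG : X ^ (m + 1) * S
      = X ^ m * P' + c' * (P * C sigma3) - c' * (truncLE m V * P) := by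
    have h1 : P * C sigma3 - truncLE m V * P = X ^ (m + 1) * (tail (m + 1) V * P) := by
      rw [← hV, ← sub_mul]
      nth_rewrite 1 [eq_truncLE_add_tail m V]
      rw [add_sub_cancel_left, mul_assoc]
    rw [pow_succ, mul_assoc, ← hS, mul_add, ← mul_assoc (X ^ m) c', hXc, add_sub_assoc, ← mul_sub,
      h1, mul_assoc c', ← mul_assoc (X ^ m) X, ← pow_succ]
  have hPs : ∀ k, n + 1 < k → coeff k (P * C sigma3) = 0 := fun k hk => by
    rw [coeff_mul_C, hdeg k hk, zero_mul]
  have hS0 : wsum B Z n S = 0 := by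
    rw [← wsum_X_pow_mul B Z n (m + 1) S, hG, wsum_sub, wsum_add, wsum_C_mul, wsum_C_mul,
      show n + (m + 1) = n + 1 + m by ring, wsum_X_pow_mul, wsum_truncLE_mul B Z hdeg hP,
      wsum_add_of_degree_le B Z hPs]
    refine Eq.trans ?_ hder
    simp
  have hS' : S = 0 := by
    ext1 k
    rw [map_zero]
    by_cases hk : k ≤ n
    · exact hinj S hS0 k hk
    · rw [← coeff_X_pow_mul S (m + 1) k, hG, map_sub, map_add, coeff_C_mul, coeff_C_mul,
        hPs _ (by omega), coeff_truncLE_mul_eq_zero hdeg m V (by omega),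
        show k + (m + 1) = (k + 1) + m by ring, coeff_X_pow_mul, hdeg' _ (by omega)]
      simp
  rw [hS', mul_zero] at hS
  exact eq_neg_of_add_eq_zero_left hS

end evaluation

/-! ### The resolvent `V = Pσ₃P⁻¹` and its Lax equation. -/

section resolvent

/-- The formal inverse of a power series with constant term `1`. -/
lemma exists_inverse {P : M2⟦X⟧} (h : coeff 0 P = 1) : ∃ Q, P * Q = 1 ∧ Q * P = 1 :=
  ⟨invOfUnit P 1, mul_invOfUnit P 1 (by simpa using h), invOfUnit_mul P 1 (by simpa using h)⟩

/-- The series `P σ₃ P⁻¹`. -/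
def resolvent (P : M2⟦X⟧) : M2⟦X⟧ := P * C sigma3 * invOfUnit P 1

lemma resolvent_mul {P : M2⟦X⟧} (h : coeff 0 P = 1) : resolvent P * P = P * C sigma3 := by
  rw [resolvent, mul_assoc, invOfUnit_mul P 1 (by simpa using h), mul_one]

lemma mul_right_cancel_of_coeff_zero {P F G : M2⟦X⟧} (h : coeff 0 P = 1) (hFG : F * P = G * P) :
    F = G := by
  obtain ⟨Q, hQ, -⟩ := exists_inverse h
  rw [← mul_one F, ← mul_one G, ← hQ, ← mul_assoc, ← mul_assoc, hFG]

lemma resolvent_mul_self {P : M2⟦X⟧} (h : coeff 0 P = 1) : resolvent P * resolvent P = 1 := by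
  refine mul_right_cancel_of_coeff_zero h ?_
  rw [mul_assoc, resolvent_mul h, ← mul_assoc, resolvent_mul h, mul_assoc, ← map_mul,
    sigma3_mul_self, map_one, mul_one, one_mul]

lemma coeff_zero_resolvent {P : M2⟦X⟧} (h : coeff 0 P = 1) : coeff 0 (resolvent P) = sigma3 := by
  have := congrArg (coeff 0) (resolvent_mul h)
  simpa only [coeff_mul_C, coeff_mul, Finset.Nat.antidiagonal_zero, Finset.sum_singleton, h, mul_one, coeff_zero_C,
    one_mul] using this

/-- Comparison of the `X`-coefficients in `VP = Pσ₃`; the commutator has zero diagonal, and its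
off-diagonal entries will be `q` and `r`. -/
lemma coeff_one_resolvent {P : M2⟦X⟧} (h : coeff 0 P = 1) :
    coeff 1 (resolvent P) = coeff 1 P * sigma3 - sigma3 * coeff 1 P := by
  have := congrArg (coeff 1) (resolvent_mul h)
  rw [coeff_mul, coeff_mul_C, Finset.Nat.antidiagonal_succ] at this
  simp only [Finset.Nat.antidiagonal_zero, Finset.map_singleton, Finset.sum_cons,
    Finset.sum_singleton, coeff_zero_resolvent h] at this
  simp only [Function.Embedding.prodMap, Function.Embedding.coeFn_mk, Prod.map] at this
  simp [h, -coeff_zero_eq_constantCoeff] at this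
  rw [← this]; abel

/-- The `x`-evolution of the resolvent. -/
lemma X_mul_deriv_resolvent {P P' V' : M2⟦X⟧} (h : coeff 0 P = 1)
    (hP' : P' = -(X * (tail 2 (resolvent P) * P)))
    (hV' : V' * P + resolvent P * P' = P' * C sigma3) :
    X * V' = truncLE 1 (resolvent P) * resolvent P - resolvent P * truncLE 1 (resolvent P) := by
  set V := resolvent P
  set U := truncLE 1 V
  have hV := resolvent_mul h
  -- In terms of `λ`, the negative part of `λV` is `λ(V - U)`, where `λU` is the polynomial part.
  have h1 : X * P' = (U - V) * P := by
    have := eq_truncLE_add_tail 1 V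
    rw [hP', mul_neg, ← mul_assoc, ← mul_assoc, ← pow_two, ← neg_mul]
    congr 1
    rw [show X ^ 2 * tail 2 V = V - U from eq_sub_of_add_eq' this.symm, neg_sub]
  refine mul_right_cancel_of_coeff_zero h ?_
  have h2 : X * V' * P = X * P' * C sigma3 - V * (X * P') := by
    rw [← mul_assoc V, ← X_mul (φ := V), mul_assoc, mul_assoc, mul_assoc, ← mul_sub, ← hV',
      add_sub_cancel_right]
  rw [h2, h1, mul_assoc, ← hV]
  noncomm_ring

end resolvent

/-! ### The resolvent and the differential polynomials `abc` -/

section derivatives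

/-- Coefficientwise derivative of a family of power series. -/
def HasDerivSeries (F : ℂ → M2⟦X⟧) (F' : M2⟦X⟧) (s : ℂ) : Prop :=
  ∀ k i j, HasDerivAt (fun z => coeff k (F z) i j) (coeff k F' i j) s

lemma HasDerivSeries.unique {F : ℂ → M2⟦X⟧} {F₁ F₂ : M2⟦X⟧} {s : ℂ}
    (h₁ : HasDerivSeries F F₁ s) (h₂ : HasDerivSeries F F₂ s) : F₁ = F₂ := by
  ext k i j
  exact (h₁ k i j).unique (h₂ k i j)

lemma hasDerivSeries_const (F : M2⟦X⟧) (s : ℂ) : HasDerivSeries (fun _ => F) 0 s := by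
  intro k i j
  simpa using hasDerivAt_const s _

lemma HasDerivSeries.mul {F G : ℂ → M2⟦X⟧} {F' G' : M2⟦X⟧} {s : ℂ}
    (hF : HasDerivSeries F F' s) (hG : HasDerivSeries G G' s) :
    HasDerivSeries (fun z => F z * G z) (F' * G s + F s * G') s := by
  intro k i j
  simp only [map_add, coeff_mul, ← Finset.sum_add_distrib, Matrix.sum_apply, Matrix.mul_apply,
    Matrix.add_apply]
  refine HasDerivAt.fun_sum fun p _ => HasDerivAt.fun_sum fun a _ => ?_
  exact (hF p.1 i a).mul (hG p.2 a j)

/-- The coefficients of the inverse are polynomial in those of `P` by recursion. Only existence of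
the derivative matters here, since the relation it satisfies follows from `VP = Pσ₃`. -/
lemma HasDerivSeries.invOfUnit {P : ℂ → M2⟦X⟧} {P' : M2⟦X⟧} {s : ℂ}
    (hP : HasDerivSeries P P' s) : ∃ Q', HasDerivSeries (fun z => invOfUnit (P z) 1) Q' s := by
  have h : ∀ k i j, DifferentiableAt ℂ (fun z => coeff k (PowerSeries.invOfUnit (P z) 1) i j) s := by
    intro k
    induction k using Nat.strong_induction_on with
    | _ k ih =>
    intro i j
    by_cases hk : k = 0
    · simp_rw [hk, coeff_zero_eq_constantCoeff_apply, constantCoeff_invOfUnit]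
      exact differentiableAt_const _
    · have hrec := fun z => coeff_invOfUnit k (P z) 1
      simp only [if_neg hk] at hrec
      simp only [hrec, inv_one, Units.val_one, neg_one_mul, Matrix.neg_apply,
        Matrix.sum_apply]
      refine DifferentiableAt.neg (DifferentiableAt.fun_sum fun p _ => ?_)
      by_cases hp : p.2 < k
      · simp only [if_pos hp, Matrix.mul_apply]
        exact DifferentiableAt.fun_sum fun a _ =>
          (hP p.1 i a).differentiableAt.mul (ih p.2 hp a j)
      · simp [hp]
  exact ⟨PowerSeries.mk fun k => Matrix.of fun i j =>
    deriv (fun z => coeff k (PowerSeries.invOfUnit (P z) 1) i j) s, fun k i j => by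
      simpa using (h k i j).hasDerivAt⟩

lemma hasDerivSeries_resolvent {P : ℂ → M2⟦X⟧} {P' : M2⟦X⟧} {s : ℂ} (h0 : ∀ z, coeff 0 (P z) = 1)
    (hP : HasDerivSeries P P' s) :
    ∃ V', HasDerivSeries (fun z => resolvent (P z)) V' s ∧
      V' * P s + resolvent (P s) * P' = P' * C sigma3 := by
  obtain ⟨Q', hQ⟩ := hP.invOfUnit
  have hσ := hP.mul (hasDerivSeries_const (C sigma3) s)
  have hV := hσ.mul hQ
  refine ⟨_, hV, ?_⟩
  have h1 := hV.mul hP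
  have h2 : (fun z => P z * C sigma3 * PowerSeries.invOfUnit (P z) 1 * P z)
      = fun z => P z * C sigma3 := by
    funext z
    exact resolvent_mul (h0 z)
  rw [h2] at h1
  have := h1.unique hσ
  refine Eq.trans ?_ (this.trans (by rw [mul_zero, add_zero]))
  rfl

end derivatives

section evaluation

/-- Evaluation of a differential polynomial on two functions of one variable. -/
def ev (q r : ℂ → ℂ) (s : ℂ) : DiffPoly →ₐ[ℂ] ℂ :=
  MvPolynomial.aeval (Sum.elim (fun i => iteratedDeriv i q s) (fun i => iteratedDeriv i r s))

lemma ev_qv (q r : ℂ → ℂ) (s : ℂ) : ev q r s (qv 0) = q s := by simp [ev, qv]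

lemma ev_rv (q r : ℂ → ℂ) (s : ℂ) : ev q r s (rv 0) = r s := by simp [ev, rv]

lemma hasDerivAt_iteratedDeriv {q : ℂ → ℂ} {s : ℂ} (hq : AnalyticAt ℂ q s) (i : ℕ) :
    HasDerivAt (iteratedDeriv i q) (iteratedDeriv (i + 1) q s) s := by
  rw [iteratedDeriv_succ]
  rw [iteratedDeriv_eq_iterate]
  exact (hq.iterated_deriv i).differentiableAt.hasDerivAt

/-- Chain rule on the variables, Leibniz rule on products; analyticity supplies the derivatives of
every order. -/
lemma hasDerivAt_ev {q r : ℂ → ℂ} {s : ℂ} (hq : AnalyticAt ℂ q s) (hr : AnalyticAt ℂ r s)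
    (p : DiffPoly) : HasDerivAt (fun z => ev q r z p) (ev q r s (D p)) s := by
  have hX : ∀ v, HasDerivAt (fun z => ev q r z (MvPolynomial.X v))
      (ev q r s (MvPolynomial.X (shift v))) s := by
    rintro (i | i)
    · simpa [ev, shift] using hasDerivAt_iteratedDeriv hq i
    · simpa [ev, shift] using hasDerivAt_iteratedDeriv hr i
  induction p using MvPolynomial.induction_on with
  | C a => simpa [MvPolynomial.derivation_C, ev] using hasDerivAt_const s a
  | add p₁ p₂ h₁ h₂ => simpa only [map_add] using h₁.fun_add h₂
  | mul_X p v h =>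
    have := h.mul (hX v)
    simp only [map_mul, Derivation.leibniz, D_X, map_add, smul_eq_mul]
    convert! this using 1
    ring

end evaluation

section coefficients

variable {O : Set ℂ} {P : ℂ → M2⟦X⟧}

/-- This is the coefficient form of `V' = [λσ₃ + V₁, V]`. -/
lemma hasDerivAt_coeff_resolvent {s : ℂ} (h0 : ∀ z, coeff 0 (P z) = 1)
    (hP : HasDerivSeries P (-(X * (tail 2 (resolvent (P s)) * P s))) s) (k : ℕ) (i j : Fin 2) :
    HasDerivAt (fun z => coeff k (resolvent (P z)) i j)
      ((sigma3 * coeff (k + 1) (resolvent (P s)) + coeff 1 (resolvent (P s)) * coeff k (resolvent (P s))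
        - coeff (k + 1) (resolvent (P s)) * sigma3
        - coeff k (resolvent (P s)) * coeff 1 (resolvent (P s))) i j) s := by
  obtain ⟨V', hV, h⟩ := hasDerivSeries_resolvent h0 hP
  have h1 := X_mul_deriv_resolvent (h0 s) rfl h
  have hU : truncLE 1 (resolvent (P s)) = C sigma3 + C (coeff 1 (resolvent (P s))) * X := by
    simp only [truncLE, Finset.sum_range_succ, Finset.sum_range_zero, zero_add, pow_zero, pow_one,
      mul_one, coeff_zero_resolvent (h0 s)]
  have h2 := congrArg (coeff (k + 1)) h1
  rw [hU, coeff_succ_X_mul, map_sub, add_mul, mul_add, map_add, map_add, mul_assoc, coeff_C_mul,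
    coeff_C_mul, coeff_succ_X_mul, coeff_mul_C, ← mul_assoc, coeff_succ_mul_X, coeff_mul_C] at h2
  have h3 := hV k i j
  rw [h2] at h3
  convert h3 using 1
  rw [sub_sub]

/-- The coefficients of the resolvent are the values of the differential polynomials `abc`. -/
theorem ev_abc (hO : IsOpen O) (h0 : ∀ z, coeff 0 (P z) = 1)
    (hP : ∀ s ∈ O, HasDerivSeries P (-(X * (tail 2 (resolvent (P s)) * P s))) s)
    {q r : ℂ → ℂ} (hq : ∀ s ∈ O, AnalyticAt ℂ q s) (hr : ∀ s ∈ O, AnalyticAt ℂ r s)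
    (hV1 : ∀ s ∈ O, coeff 1 (resolvent (P s)) = !![0, q s; r s, 0]) (k : ℕ) :
    ∀ s ∈ O, coeff k (resolvent (P s))
      = !![ev q r s (abc k).1, ev q r s (abc k).2.1; ev q r s (abc k).2.2, -ev q r s (abc k).1] := by
  induction k using Nat.strong_induction_on with
  | _ k ih =>
  intro s hs
  rcases k with _ | k
  · rw [coeff_zero_resolvent (h0 s), abc_zero]
    simp [sigma3]
  set V := resolvent (P s) with hVdef
  have hVk : coeff k V = _ := ih k (by omega) s hs
  have hder := hasDerivAt_coeff_resolvent h0 (hP s hs) k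
  -- The induction hypothesis is differentiated, so it is needed on a neighbourhood of `s`; this is
  -- why `O` is open.
  have hloc : ∀ i j, (fun z => coeff k (resolvent (P z)) i j) =ᶠ[nhds s] fun z =>
      (!![ev q r z (abc k).1, ev q r z (abc k).2.1;
        ev q r z (abc k).2.2, -ev q r z (abc k).1] : M2) i j := by
    intro i j
    filter_upwards [hO.mem_nhds hs] with z hz
    rw [ih k (by omega) z hz]
  -- The off-diagonal entries of `[σ₃, V_{k+1}]` are `2b` and `-2c`, so the Lax equation determines
  -- those of `V_{k+1}` from `V_k` and its derivative.
  have hb : ev q r s (D (abc k).2.1) = 2 * coeff (k + 1) V 0 1 - 2 * q s * ev q r s (abc k).1 := by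
    have h1 := hder 0 1
    have h2 := (hasDerivAt_ev (hq s hs) (hr s hs) (abc k).2.1).congr_of_eventuallyEq (hloc 0 1)
    rw [h2.unique h1, ← hVdef, hVk, hV1 s hs]
    simp only [Matrix.sub_apply, Matrix.add_apply, Matrix.mul_apply, Fin.sum_univ_two]
    simp [sigma3]
    ring
  have hc : ev q r s (D (abc k).2.2) = -2 * coeff (k + 1) V 1 0 + 2 * r s * ev q r s (abc k).1 := by
    have h1 := hder 1 0
    have h2 := (hasDerivAt_ev (hq s hs) (hr s hs) (abc k).2.2).congr_of_eventuallyEq (hloc 1 0)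
    rw [h2.unique h1, ← hVdef, hVk, hV1 s hs]
    simp only [Matrix.sub_apply, Matrix.add_apply, Matrix.mul_apply, Fin.sum_univ_two]
    simp [sigma3]
    ring
  have hb' : coeff (k + 1) V 0 1 = ev q r s (abc (k + 1)).2.1 := by
    rw [D_b, map_sub, map_mul, map_mul, map_mul, map_ofNat, ev_qv] at hb
    linear_combination (-1 / 2 : ℂ) * hb
  have hc' : coeff (k + 1) V 1 0 = ev q r s (abc (k + 1)).2.2 := by
    rw [D_c, map_add, map_mul, map_mul, map_mul, map_neg, map_ofNat, ev_rv] at hc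
    linear_combination (1 / 2 : ℂ) * hc
  set S : ℂ := ∑ i ∈ Finset.range k,
    (ev q r s (abc (i + 1)).1 * ev q r s (abc (k - i)).1
      + ev q r s (abc (i + 1)).2.1 * ev q r s (abc (k - i)).2.2) with hS
  have ha : 2 * ev q r s (abc (k + 1)).1 = -S := by
    have := congrArg (ev q r s) (two_a k)
    rw [map_mul, map_ofNat, map_neg, map_sum] at this
    rw [this, hS, ← Fin.sum_univ_eq_sum_range (fun i => ev q r s (abc (i + 1)).1 * ev q r s (abc (k - i)).1
      + ev q r s (abc (i + 1)).2.1 * ev q r s (abc (k - i)).2.2)]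
    simp
  -- The lower right entry of the products has the same terms in reversed order.
  have hS2 : ∑ i ∈ Finset.range k,
    (ev q r s (abc (i + 1)).2.2 * ev q r s (abc (k - i)).2.1
      + ev q r s (abc (i + 1)).1 * ev q r s (abc (k - i)).1) = S := by
    rw [← Finset.sum_range_reflect, hS]
    refine Finset.sum_congr rfl fun i hi => ?_
    have hi' := Finset.mem_range.mp hi
    rw [show k - 1 - i + 1 = k - i by omega, show k - (k - 1 - i) = i + 1 by omega]
    ring
  -- The diagonal of `V_{k+1}` is invisible in `[σ₃, V_{k+1}]`; it comes from `V² = 1`, where the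
  -- anticommutator with `σ₃` isolates it. No integration is required.
  have hsq : sigma3 * coeff (k + 1) V + coeff (k + 1) V * sigma3
      + ∑ i ∈ Finset.range k, coeff (i + 1) V * coeff (k - i) V = 0 := by
    have h1 := congrArg (coeff (k + 1)) (resolvent_mul_self (h0 s))
    rw [coeff_mul, Finset.Nat.sum_antidiagonal_eq_sum_range_succ
      (f := fun i j => coeff i V * coeff j V), Finset.sum_range_succ, Finset.sum_range_succ',
      coeff_one, if_neg (Nat.succ_ne_zero k)] at h1
    rw [← h1]
    simp only [Nat.sub_self, Nat.sub_zero, Nat.add_sub_add_right]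
    rw [coeff_zero_resolvent (h0 s)]
    abel
  have hsum : ∑ i ∈ Finset.range k, coeff (i + 1) V * coeff (k - i) V
      = ∑ i ∈ Finset.range k,
        (!![ev q r s (abc (i + 1)).1, ev q r s (abc (i + 1)).2.1;
          ev q r s (abc (i + 1)).2.2, -ev q r s (abc (i + 1)).1] : M2)
        * !![ev q r s (abc (k - i)).1, ev q r s (abc (k - i)).2.1;
          ev q r s (abc (k - i)).2.2, -ev q r s (abc (k - i)).1] := by
    refine Finset.sum_congr rfl fun i hi => ?_
    have hi' := Finset.mem_range.mp hi
    rw [ih (i + 1) (by omega) s hs, ih (k - i) (by omega) s hs]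
  rw [hsum] at hsq
  have h00 := congrFun (congrFun hsq 0) 0
  have h11 := congrFun (congrFun hsq 1) 1
  simp only [Matrix.add_apply, Matrix.mul_apply, Fin.sum_univ_two, Matrix.sum_apply] at h00 h11
  simp [sigma3] at h00 h11
  rw [← hS] at h00
  rw [hS2] at h11
  ext i j
  fin_cases i <;> fin_cases j
  · simp
    linear_combination (1 / 2 : ℂ) * h00 - (1 / 2 : ℂ) * ha
  · simpa using hb'
  · simpa using hc'
  · simp
    linear_combination (-1 / 2 : ℂ) * h11 + (1 / 2 : ℂ) * ha

end coefficients

/-! ### The Darboux matrix of a double Wronskian -/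

section darboux

variable (n : ℕ)

/-- The matrix with the columns `u, -Bu, …, (-B)ᵃ⁻¹u, v, Bv, …`. -/
def krylov {N : ℕ} (a : ℕ) (B : Matrix (Fin N) (Fin N) ℂ) (u v : Fin N → ℂ) :
    Matrix (Fin N) (Fin N) ℂ :=
  Matrix.of fun i j => if (j : ℕ) < a then ((-B) ^ (j : ℕ) *ᵥ u) i else (B ^ (j - a : ℕ) *ᵥ v) i

/-- The matrix with the columns `v` and `-u`. -/
def pairMat {N : ℕ} (u v : Fin N → ℂ) : Matrix (Fin N) (Fin 2) ℂ :=
  Matrix.of fun i j => if j = 0 then v i else -u i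

/-- The coordinates of the `i`-th row of a series truncated at degree `n`, with respect to the
columns of `krylov (n + 1) B u v`. -/
def coords (S : M2⟦X⟧) (i : Fin 2) : Fin (n + 1 + (n + 1)) → ℂ :=
  Fin.append (fun e => -(-1) ^ (e : ℕ) * coeff (n - e) S i 1) (fun e => coeff (n - e) S i 0)

/-- The series of degree at most `n` with given coordinates. -/
def ofCoords (c : Fin 2 → Fin (n + 1 + (n + 1)) → ℂ) : M2⟦X⟧ :=
  PowerSeries.mk fun k => if k ≤ n then Matrix.of fun i j =>
    if j = 0 then c i (Fin.natAdd (n + 1) ⟨n - k, by omega⟩)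
    else -(-1) ^ (n - k) * c i (Fin.castAdd (n + 1) ⟨n - k, by omega⟩) else 0

lemma coords_ofCoords (c : Fin 2 → Fin (n + 1 + (n + 1)) → ℂ) (i : Fin 2) :
    coords n (ofCoords n c) i = c i := by
  funext x
  refine Fin.addCases (fun e => ?_) (fun e => ?_) x
  · have he : n - (n - (e : ℕ)) = e := by omega
    have hp : (-1 : ℂ) ^ (e : ℕ) * (-1) ^ (e : ℕ) = 1 := by rw [← mul_pow]; simp
    simp only [coords, Fin.append_left, ofCoords, coeff_mk, if_pos (Nat.sub_le n e), he,
      Matrix.of_apply, one_ne_zero, if_false]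
    linear_combination c i (Fin.castAdd (n + 1) e) * hp
  · have he : n - (n - (e : ℕ)) = e := by omega
    simp only [coords, Fin.append_right, ofCoords, coeff_mk, if_pos (Nat.sub_le n e), he,
      Matrix.of_apply, if_true]

lemma coeff_eq_zero_of_coords {S : M2⟦X⟧} (h : ∀ i, coords n S i = 0) {k : ℕ} (hk : k ≤ n) :
    coeff k S = 0 := by
  ext i j
  have he : n - (n - k) = k := by omega
  fin_cases j
  · have := congrFun (h i) (Fin.natAdd (n + 1) ⟨n - k, by omega⟩)
    simp only [coords, Fin.append_right, he] at this
    simpa using this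
  · have := congrFun (h i) (Fin.castAdd (n + 1) ⟨n - k, by omega⟩)
    simp only [coords, Fin.append_left, he] at this
    simpa using this

variable {n} (B : Matrix (Fin (n + 1 + (n + 1))) (Fin (n + 1 + (n + 1))) ℂ)
  (u v : Fin (n + 1 + (n + 1)) → ℂ)

/-- The powers `Bᵉ` applied to the columns `v` and `-u` are, up to sign, the columns of the Krylov
matrix; the signs and the reversal `e = n - k` in `coords` account for the difference. -/
lemma wsum_eq_krylov_mulVec (S : M2⟦X⟧) (i : Fin 2) :
    (fun x => wsum B (pairMat u v) n S x i) = krylov (n + 1) B u v *ᵥ coords n S i := by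
  funext x
  have hterm : ∀ M : Matrix (Fin (n + 1 + (n + 1))) (Fin (n + 1 + (n + 1))) ℂ, ∀ G : M2,
      (M * pairMat u v * Gᵀ) x i = (M *ᵥ v) x * G i 0 - (M *ᵥ u) x * G i 1 := by
    intro M G
    simp [Matrix.mul_apply, Fin.sum_univ_two, pairMat, Matrix.mulVec, dotProduct]
    ring
  rw [wsum, ← Finset.sum_range_reflect, Matrix.sum_apply, show (krylov (n + 1) B u v *ᵥ coords n S i) x
    = ∑ j, krylov (n + 1) B u v x j * coords n S i j from rfl, Fin.sum_univ_add]
  simp only [hterm, krylov, coords, Fin.append_left,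
    Fin.append_right, Matrix.of_apply, Fin.val_castAdd, Fin.val_natAdd, Fin.is_lt, if_true,
    show ∀ e : Fin (n + 1), ¬ (n + 1 + (e : ℕ) < n + 1) from fun e => by omega, if_false,
    Nat.add_sub_cancel_left]
  rw [Fin.sum_univ_eq_sum_range (fun e => ((-B) ^ e *ᵥ u) x
    * (-(-1) ^ e * coeff (n - e) S i 1)), Fin.sum_univ_eq_sum_range (fun e => (B ^ e *ᵥ v) x
    * coeff (n - e) S i 0), ← Finset.sum_add_distrib]
  refine Finset.sum_congr rfl fun e he => ?_
  have := Finset.mem_range.mp he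
  have hp : (-1 : ℂ) ^ e * (-1) ^ e = 1 := by rw [← mul_pow]; simp
  have hB : ((-B) ^ e *ᵥ u) x = (-1) ^ e * (B ^ e *ᵥ u) x := by
    have : (-B) ^ e = ((-1 : ℂ) ^ e) • B ^ e := by
      rw [← neg_one_smul ℂ B, smul_pow]
    rw [this, Matrix.smul_mulVec, Pi.smul_apply, smul_eq_mul]
  rw [hB, show n + 1 - 1 - e = n - e by omega, show n - (n - e) = e by omega]
  linear_combination (B ^ e *ᵥ u) x * coeff (n - e) S i 1 * hp

variable {B u v}

lemma coeff_eq_zero_of_wsum_eq_zero (h : (krylov (n + 1) B u v).det ≠ 0) (S : M2⟦X⟧)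
    (hS : wsum B (pairMat u v) n S = 0) : ∀ k ≤ n, coeff k S = 0 := by
  refine fun k hk => coeff_eq_zero_of_coords n (fun i => ?_) hk
  refine Matrix.eq_zero_of_mulVec_eq_zero h ?_
  rw [← wsum_eq_krylov_mulVec, hS]
  rfl

/-- The converse of the uniqueness statement, used to carry nonvanishing of `f` over to the
reflected times. -/
lemma det_krylov_ne_zero
    (h : ∀ S : M2⟦X⟧, wsum B (pairMat u v) n S = 0 → ∀ k ≤ n, coeff k S = 0) :
    (krylov (n + 1) B u v).det ≠ 0 := by
  intro h0
  obtain ⟨c, hc, hc0⟩ := Matrix.exists_mulVec_eq_zero_iff.mpr h0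
  set S := ofCoords n (fun _ => c)
  have hS : wsum B (pairMat u v) n S = 0 := by
    ext x i
    rw [congrFun (wsum_eq_krylov_mulVec B u v S i) x, coords_ofCoords, hc0]
    rfl
  refine hc ?_
  rw [← coords_ofCoords n (fun _ => c) 0]
  funext x
  refine Fin.addCases (fun e => ?_) (fun e => ?_) x
  · simp only [coords, Fin.append_left]
    rw [h S hS _ (Nat.sub_le n e)]
    simp
  · simp only [coords, Fin.append_right]
    rw [h S hS _ (Nat.sub_le n e)]
    simp

variable (B u v)

/-- The Darboux matrix in the variable `1/λ`: the series `P = 1 + O(1/λ)` of degree `n + 1` that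
is annihilated by `wsum B (pairMat u v) (n + 1)`. -/
def darboux : M2⟦X⟧ :=
  1 + X * ofCoords n fun i => -(krylov (n + 1) B u v).det⁻¹ •
    Matrix.cramer (krylov (n + 1) B u v) fun x => (B ^ (n + 1) * pairMat u v) x i

/-- Holds also at a vanishing determinant, where `0⁻¹ = 0` makes the series equal to `1`; the formal
inverse therefore makes sense at all times. -/
lemma coeff_zero_darboux : coeff 0 (darboux B u v) = 1 := by
  rw [darboux, map_add, coeff_zero_X_mul, coeff_zero_one, add_zero]

lemma coeff_succ_darboux (k : ℕ) : coeff (k + 1) (darboux B u v)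
    = coeff k (ofCoords n fun i => -(krylov (n + 1) B u v).det⁻¹ •
      Matrix.cramer (krylov (n + 1) B u v) fun x => (B ^ (n + 1) * pairMat u v) x i) := by
  rw [darboux, map_add, coeff_succ_X_mul, coeff_one, if_neg (Nat.succ_ne_zero k), zero_add]

lemma coeff_darboux_eq_zero {k : ℕ} (hk : n + 1 < k) : coeff k (darboux B u v) = 0 := by
  obtain ⟨k, rfl⟩ : ∃ j, k = j + 1 := ⟨k - 1, by omega⟩
  rw [coeff_succ_darboux, ofCoords, coeff_mk, if_neg (by omega)]

lemma wsum_one {N : ℕ} (B : Matrix (Fin N) (Fin N) ℂ) (Z : Matrix (Fin N) (Fin 2) ℂ) (d : ℕ) :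
    wsum B Z d 1 = B ^ d * Z := by
  have h : ∀ k, 0 < k → coeff k (1 : M2⟦X⟧) = 0 := fun k hk => by rw [coeff_one, if_neg hk.ne']
  have h0 : wsum B Z 0 1 = Z := by simp [wsum]
  rw [← zero_add d, wsum_add_of_degree_le B Z h, h0, zero_add]

variable {B u v}

lemma wsum_darboux (h : (krylov (n + 1) B u v).det ≠ 0) :
    wsum B (pairMat u v) (n + 1) (darboux B u v) = 0 := by
  rw [darboux, wsum_add, wsum_one, wsum_X_mul]
  ext x i
  rw [Matrix.add_apply, congrFun (wsum_eq_krylov_mulVec B u v _ i) x, coords_ofCoords,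
    Matrix.mulVec_smul, Matrix.mulVec_cramer]
  simp [h]

/-- Two normalized solutions differ by `X` times a solution of the homogeneous system, whose
coefficients up to degree `n` vanish. -/
lemma coeff_eq_coeff_darboux (h : (krylov (n + 1) B u v).det ≠ 0) {F : M2⟦X⟧}
    (hF0 : coeff 0 F = 1) (hF : wsum B (pairMat u v) (n + 1) F = 0) {k : ℕ} (hk : k ≤ n + 1) :
    coeff k F = coeff k (darboux B u v) := by
  obtain ⟨S, hS⟩ : ∃ S, F - darboux B u v = X * S := by
    refine X_dvd_iff.mpr ?_
    rw [← coeff_zero_eq_constantCoeff_apply, map_sub, hF0, coeff_zero_darboux, sub_self]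
  have hS0 : wsum B (pairMat u v) n S = 0 := by
    rw [← wsum_X_mul, ← hS, wsum_sub, hF, wsum_darboux h, sub_zero]
  rw [← sub_eq_zero, ← map_sub, hS]
  rcases k with _ | k
  · rw [coeff_zero_X_mul]
  · rw [coeff_succ_X_mul]
    exact coeff_eq_zero_of_wsum_eq_zero h S hS0 k (by omega)

variable (B u v)

/-- Both matrices have the same columns: moving `B^{n+1}v` from position `n` to the last position is
a cycle of length `n + 2`, of sign `(-1)^{n+1}`. -/
lemma det_krylov_eq : (krylov n B u v).det = (-1) ^ (n + 1) *
    ((krylov (n + 1) B u v).updateCol ⟨n, by omega⟩ (B ^ (n + 1) *ᵥ v)).det := by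
  have hle : (⟨n, by omega⟩ : Fin (n + 1 + (n + 1))) ≤ Fin.last (n + 1 + n) := Fin.le_last _
  have hs : Equiv.Perm.sign (Fin.cycleIcc (⟨n, by omega⟩ : Fin (n + 1 + (n + 1)))
      (Fin.last (n + 1 + n))) = (-1) ^ (n + 1) := by
    rw [Fin.sign_cycleIcc_of_le hle]
    congr 1
    simp only [Fin.val_last]
    omega
  have hd := Matrix.det_permute' (Fin.cycleIcc (⟨n, by omega⟩ : Fin (n + 1 + (n + 1)))
      (Fin.last (n + 1 + n)))
    ((krylov (n + 1) B u v).updateCol ⟨n, by omega⟩ (B ^ (n + 1) *ᵥ v))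
  rw [hs] at hd
  refine Eq.trans ?_ (hd.trans (by simp))
  congr 1
  ext x j
  rw [Matrix.submatrix_apply, id]
  rcases lt_trichotomy (j : ℕ) n with h | h | h
  · rw [Fin.cycleIcc_of_lt (by exact h), Matrix.updateCol_ne (by intro h'; subst h'; simp at h)]
    simp only [krylov, Matrix.of_apply, if_pos h, if_pos (h.trans (Nat.lt_succ_self n))]
  all_goals
    by_cases hj : (j : ℕ) = n + 1 + n
    · obtain rfl : j = Fin.last (n + 1 + n) := Fin.ext hj
      rw [Fin.cycleIcc_of_last hle, Matrix.updateCol_self]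
      have h1 : ¬ (n + 1 + n < n) := by omega
      have h2 : n + 1 + n - n = n + 1 := by omega
      simp [krylov, h1, h2]
    · have hlt : j < Fin.last (n + 1 + n) := by
        rw [Fin.lt_def, Fin.val_last]; omega
      have hv : ((j + 1 : Fin (n + 1 + (n + 1))) : ℕ) = j + 1 := Fin.val_add_one_of_lt hlt
      rw [Fin.cycleIcc_of_ge_of_lt (by rw [Fin.le_def]; simp only; omega) hlt, Matrix.updateCol_ne
        (by intro h'; have := congrArg Fin.val h'; rw [hv] at this; simp only at this; omega)]
      simp only [krylov, Matrix.of_apply, hv, if_neg (show ¬ ((j : ℕ) < n) by omega),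
        if_neg (show ¬ ((j : ℕ) + 1 < n + 1) by omega), Nat.add_sub_add_right]

/-- Cramer's rule for the coordinate along `(-B)ⁿu`; the sign `(-1)ⁿ` from `ofCoords` combines with
the sign of the column cycle. -/
lemma coeff_one_darboux : coeff 1 (darboux B u v) 0 1
    = -((krylov n B u v).det / (krylov (n + 1) B u v).det) := by
  have hv : (fun x => (B ^ (n + 1) * pairMat u v) x 0) = B ^ (n + 1) *ᵥ v := by
    funext x
    simp [Matrix.mul_apply, pairMat, Matrix.mulVec, dotProduct]
  have h1 := coeff_succ_darboux B u v 0
  rw [zero_add] at h1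
  rw [h1, det_krylov_eq]
  simp only [ofCoords, coeff_mk, if_pos (Nat.zero_le n), Matrix.of_apply, one_ne_zero, if_false,
    Nat.sub_zero, hv, Pi.smul_apply, Matrix.cramer_apply, smul_eq_mul]
  have : (Fin.castAdd (n + 1) ⟨n, by omega⟩ : Fin (n + 1 + (n + 1))) = ⟨n, by omega⟩ := rfl
  rw [this, pow_succ]
  ring

end darboux

/-! ### Uniqueness and the symmetry `λ ↦ -σλ`. -/

section symmetry

variable {n : ℕ} {σ δ : ℂ}

/-- The action on series that corresponds to the reflection of the times. -/
def twist (σ δ : ℂ) (F : M2⟦X⟧) : M2⟦X⟧ :=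
  PowerSeries.mk fun k => (-σ) ^ k • (!![0, -(δ * σ); -1, 0] * coeff k F * !![0, -1; -(δ * σ), 0])

variable {N : ℕ} {B T : Matrix (Fin N) (Fin N) ℂ} {u v : Fin N → ℂ}

/-- Moving `T` past `Bᵉ` costs `(-σ)ᵉ`, which with the factor `(-σ)ᵏ` of the twist is the same for
all terms. The constant antidiagonal matrices exchange the two columns of data. -/
lemma mul_wsum_twist (hBT : T * B = (-σ) • (B * T)) (d : ℕ) (F : M2⟦X⟧) :
    T * wsum B (pairMat u v) d (twist σ δ F) = (-σ) ^ d •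
      (wsum B (pairMat ((δ * σ) • (T *ᵥ v)) (T *ᵥ u)) d F * !![0, -1; -(δ * σ), 0]) := by
  have hpow : ∀ e, T * B ^ e = (-σ) ^ e • (B ^ e * T) := by
    intro e
    induction e with
    | zero => simp
    | succ e ih =>
      rw [pow_succ, ← Matrix.mul_assoc, ih, Matrix.smul_mul, Matrix.mul_assoc, hBT,
        Matrix.mul_smul, smul_smul, ← pow_succ, Matrix.mul_assoc]
  have hZ : T * pairMat u v * !![0, -(δ * σ); -1, 0]
      = pairMat ((δ * σ) • (T *ᵥ v)) (T *ᵥ u) := by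
    ext x j
    fin_cases j
    · simp [Matrix.mul_apply, pairMat, Matrix.mulVec, dotProduct, Fin.sum_univ_two]
    · simp [Matrix.mul_apply, pairMat, Matrix.mulVec, dotProduct, Fin.sum_univ_two]
      ring
  have ht1 : (!![0, -(δ * σ); -1, 0] : M2)ᵀ = !![0, -1; -(δ * σ), 0] := by
    ext i j; fin_cases i <;> fin_cases j <;> rfl
  have ht2 : (!![0, -1; -(δ * σ), 0] : M2)ᵀ = !![0, -(δ * σ); -1, 0] := by
    ext i j; fin_cases i <;> fin_cases j <;> rfl
  rw [wsum, wsum, Matrix.mul_sum, Matrix.sum_mul, Finset.smul_sum]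
  refine Finset.sum_congr rfl fun k hk => ?_
  have hk' := Finset.mem_range.mp hk
  rw [← hZ, twist, coeff_mk, Matrix.transpose_smul, Matrix.transpose_mul, Matrix.transpose_mul, ht1,
    ht2, Matrix.mul_smul, Matrix.mul_smul, Matrix.mul_assoc (B ^ _), ← Matrix.mul_assoc T, hpow,
    Matrix.smul_mul, smul_smul, ← pow_add, show k + (d - k) = d by omega]
  simp only [Matrix.mul_assoc]

lemma twist_coeff_zero (hδσ : (δ * σ) * (δ * σ) = 1) {F : M2⟦X⟧} (hF : coeff 0 F = 1) :
    coeff 0 (twist σ δ F) = 1 := by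
  rw [twist, coeff_mk, hF, pow_zero, one_smul, mul_one]
  ext i j
  fin_cases i <;> fin_cases j <;> simp [Matrix.mul_apply, Fin.sum_univ_two, hδσ]

lemma wsum_twist_eq_zero (hBT : T * B = (-σ) • (B * T)) (hT : T * T = (δ * σ) • 1)
    (hδσ : (δ * σ) * (δ * σ) = 1) {d : ℕ} {F : M2⟦X⟧}
    (hF : wsum B (pairMat ((δ * σ) • (T *ᵥ v)) (T *ᵥ u)) d F = 0) :
    wsum B (pairMat u v) d (twist σ δ F) = 0 := by
  have h := mul_wsum_twist (δ := δ) (u := u) (v := v) hBT d F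
  rw [hF, Matrix.zero_mul, smul_zero] at h
  have h2 := congrArg (fun M => (δ * σ) • (T * M)) h
  simpa [← Matrix.mul_assoc, hT, smul_smul, hδσ] using h2

end symmetry

/-! ### Evolution of the Darboux matrix -/

section evolution

lemma differentiableAt_det {ι : Type*} [Fintype ι] [DecidableEq ι] {M : ℂ → Matrix ι ι ℂ} {s : ℂ}
    (h : ∀ i j, DifferentiableAt ℂ (fun z => M z i j) s) :
    DifferentiableAt ℂ (fun z => (M z).det) s := by
  simp only [Matrix.det_apply]
  exact DifferentiableAt.fun_sum fun p _ =>
    (DifferentiableAt.fun_finsetProd fun i _ => h _ _).const_smul _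

lemma differentiableAt_mulVec {N : ℕ} (M : Matrix (Fin N) (Fin N) ℂ) {u : ℂ → Fin N → ℂ} {s : ℂ}
    (h : ∀ i, DifferentiableAt ℂ (fun z => u z i) s) (i : Fin N) :
    DifferentiableAt ℂ (fun z => (M *ᵥ u z) i) s := by
  simp only [Matrix.mulVec, dotProduct]
  exact DifferentiableAt.fun_sum fun j _ => (h j).const_mul _

lemma differentiableAt_krylov {N : ℕ} (a : ℕ) (B : Matrix (Fin N) (Fin N) ℂ)
    {u v : ℂ → Fin N → ℂ} {s : ℂ} (hu : ∀ i, DifferentiableAt ℂ (fun z => u z i) s)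
    (hv : ∀ i, DifferentiableAt ℂ (fun z => v z i) s) (i j : Fin N) :
    DifferentiableAt ℂ (fun z => krylov a B (u z) (v z) i j) s := by
  simp only [krylov, Matrix.of_apply]
  split_ifs
  · exact differentiableAt_mulVec _ hu i
  · exact differentiableAt_mulVec _ hv i

lemma hasDerivAt_wsum {N : ℕ} (B : Matrix (Fin N) (Fin N) ℂ) {Z : ℂ → Matrix (Fin N) (Fin 2) ℂ}
    {Z' : Matrix (Fin N) (Fin 2) ℂ} {P : ℂ → M2⟦X⟧} {P' : M2⟦X⟧} {s : ℂ}
    (hZ : ∀ i j, HasDerivAt (fun z => Z z i j) (Z' i j) s) (hP : HasDerivSeries P P' s) (d : ℕ)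
    (i : Fin N) (j : Fin 2) : HasDerivAt (fun z => wsum B (Z z) d (P z) i j)
      ((wsum B (Z s) d P' + wsum B Z' d (P s)) i j) s := by
  have hBZ : ∀ (e : ℕ) (x : Fin N) (y : Fin 2), HasDerivAt (fun z => (B ^ e * Z z) x y) ((B ^ e * Z') x y) s := by
    intro e x y
    simp only [Matrix.mul_apply]
    exact HasDerivAt.fun_sum fun a _ => (hZ a y).const_mul _
  simp only [wsum, ← Finset.sum_add_distrib, Matrix.sum_apply]
  refine HasDerivAt.fun_sum fun k _ => ?_
  rw [Matrix.add_apply, Matrix.mul_apply, Matrix.mul_apply, ← Finset.sum_add_distrib]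
  simp only [Matrix.mul_apply (N := (coeff k (P _))ᵀ), Matrix.transpose_apply]
  refine HasDerivAt.fun_sum fun a _ => ?_
  convert! (hBZ (d - k) i a).mul (hP k j a) using 1
  ring

variable {n : ℕ} {B : Matrix (Fin (n + 1 + (n + 1))) (Fin (n + 1 + (n + 1))) ℂ}
  {u v : ℂ → Fin (n + 1 + (n + 1)) → ℂ} {s : ℂ}

/-- Every coefficient is built from quotients of determinants in the data, with nonzero denominator
at `s`. -/
lemma exists_hasDerivSeries_darboux (hu : ∀ i, DifferentiableAt ℂ (fun z => u z i) s)
    (hv : ∀ i, DifferentiableAt ℂ (fun z => v z i) s)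
    (h : (krylov (n + 1) B (u s) (v s)).det ≠ 0) :
    ∃ P', HasDerivSeries (fun z => darboux B (u z) (v z)) P' s := by
  have hdet := differentiableAt_det (differentiableAt_krylov (n + 1) B hu hv)
  have hZ : ∀ x i, DifferentiableAt ℂ (fun z => (B ^ (n + 1) * pairMat (u z) (v z)) x i) s := by
    intro x i
    simp only [Matrix.mul_apply]
    refine DifferentiableAt.fun_sum fun a _ => DifferentiableAt.const_mul ?_ _
    simp only [pairMat, Matrix.of_apply]
    split_ifs
    · exact hv a
    · exact (hu a).neg
  have hc : ∀ i x, DifferentiableAt ℂ (fun z => (-(krylov (n + 1) B (u z) (v z)).det⁻¹ •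
      Matrix.cramer (krylov (n + 1) B (u z) (v z))
        fun x => (B ^ (n + 1) * pairMat (u z) (v z)) x i) x) s := by
    intro i x
    simp only [Pi.smul_apply, Matrix.cramer_apply, smul_eq_mul]
    refine (hdet.inv h).neg.mul (differentiableAt_det fun a b => ?_)
    simp only [Matrix.updateCol_apply]
    split_ifs
    · exact hZ a i
    · exact differentiableAt_krylov (n + 1) B hu hv a b
  have hP : ∀ k i j, DifferentiableAt ℂ (fun z => coeff k (darboux B (u z) (v z)) i j) s := by
    intro k i j
    rcases k with _ | k
    · simp only [coeff_zero_darboux]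
      exact differentiableAt_const _
    · simp only [coeff_succ_darboux, ofCoords, coeff_mk]
      by_cases hk : k ≤ n
      · simp only [if_pos hk, Matrix.of_apply]
        by_cases hj : j = 0
        · simp only [if_pos hj]
          exact hc i _
        · simp only [if_neg hj]
          exact (hc i _).const_mul _
      · simp only [if_neg hk]
        exact differentiableAt_const _
  exact ⟨PowerSeries.mk fun k => Matrix.of fun i j =>
    deriv (fun z => coeff k (darboux B (u z) (v z)) i j) s, fun k i j => by
      simpa using (hP k i j).hasDerivAt⟩

/-- The evolution of the Darboux matrix along a linear flow of its data. -/
theorem hasDerivSeries_darboux {m : ℕ} {c : ℂ}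
    (hu : ∀ i, HasDerivAt (fun z => u z i) (-(c * (B ^ m *ᵥ u s) i)) s)
    (hv : ∀ i, HasDerivAt (fun z => v z i) (c * (B ^ m *ᵥ v s) i) s)
    (h : (krylov (n + 1) B (u s) (v s)).det ≠ 0) :
    HasDerivSeries (fun z => darboux B (u z) (v z))
      (-(C (c • (1 : M2)) * (X * (tail (m + 1) (resolvent (darboux B (u s) (v s)))
        * darboux B (u s) (v s))))) s := by
  have hu' := fun i => (hu i).differentiableAt
  have hv' := fun i => (hv i).differentiableAt
  obtain ⟨P', hP'⟩ := exists_hasDerivSeries_darboux hu' hv' h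
  -- The normalization at degree `0` and the vanishing above degree `n + 1` hold for all `z`, so
  -- they differentiate to conditions on `P'`.
  have hconst : ∀ k M, (∀ z, coeff k (darboux B (u z) (v z)) = M) → coeff k P' = 0 := by
    intro k M hM
    ext i j
    have := hP' k i j
    simp only [hM] at this
    exact this.unique (hasDerivAt_const s _)
  have hZ : ∀ i j, HasDerivAt (fun z => pairMat (u z) (v z) i j)
      ((c • (B ^ m * pairMat (u s) (v s) * sigma3)) i j) s := by
    intro i j
    fin_cases j
    · have := hv i
      simp only [Matrix.mulVec, dotProduct] at this
      simpa [pairMat, sigma3, Matrix.mul_apply, Fin.sum_univ_two] using this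
    · have := (hu i).fun_neg
      simp only [Matrix.mulVec, dotProduct] at this
      simpa [pairMat, sigma3, Matrix.mul_apply, Fin.sum_univ_two] using this
  have hw := hasDerivAt_wsum B hZ hP' (n + 1)
  -- The kernel condition must hold near `s` to be differentiated.
  have hev : ∀ᶠ z in nhds s, (krylov (n + 1) B (u z) (v z)).det ≠ 0 :=
    (differentiableAt_det (differentiableAt_krylov (n + 1) B hu' hv')).continuousAt.eventually_ne h
  have hw0 : wsum B (pairMat (u s) (v s)) (n + 1) P'
      + wsum B (c • (B ^ m * pairMat (u s) (v s) * sigma3)) (n + 1) (darboux B (u s) (v s)) = 0 := by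
    ext i j
    refine (hw i j).unique ((hasDerivAt_const s (0 : ℂ)).congr_of_eventuallyEq ?_)
    filter_upwards [hev] with z hz
    rw [wsum_darboux hz]
    rfl
  have hσ : wsum B (c • (B ^ m * pairMat (u s) (v s) * sigma3)) (n + 1) (darboux B (u s) (v s))
      = c • (B ^ m * wsum B (pairMat (u s) (v s)) (n + 1) (darboux B (u s) (v s) * C sigma3)) := by
    rw [wsum, wsum, Matrix.mul_sum, Finset.smul_sum]
    refine Finset.sum_congr rfl fun k _ => ?_
    rw [coeff_mul_C, Matrix.transpose_mul, sigma3_transpose, Matrix.mul_smul, Matrix.smul_mul]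
    simp only [← Matrix.mul_assoc, ← pow_add]
    rw [add_comm m]
  rw [hσ] at hw0
  have key := evolution_of_wsum_eq_zero (coeff_eq_zero_of_wsum_eq_zero h)
    (fun k hk => coeff_darboux_eq_zero B (u s) (v s) hk) (wsum_darboux h)
    (hconst 0 1 fun z => coeff_zero_darboux B (u z) (v z))
    (fun k hk => hconst k 0 fun z => coeff_darboux_eq_zero B (u z) (v z) hk) hw0
    (resolvent_mul (coeff_zero_darboux B (u s) (v s)))
  rw [← key]
  exact hP'

end evolution

/-! ### Double Wronskian quotients and the odd AKNS flows. -/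

section solution

lemma commutator_sigma3 (M : M2) :
    M * sigma3 - sigma3 * M = !![0, -2 * M 0 1; 2 * M 1 0, 0] := by
  ext i j
  fin_cases i <;> fin_cases j <;>
    simp only [Matrix.sub_apply, Matrix.mul_apply, Fin.sum_univ_two] <;> simp [sigma3] <;> ring

variable {n : ℕ} (A : Matrix (Fin (n + 1 + (n + 1))) (Fin (n + 1 + (n + 1))) ℂ)
  (Cp Cm : Fin (n + 1 + (n + 1)) → ℂ)

lemma doubleWronskian_eq_det_krylov (a : ℕ) {t : Times} (ht : Admissible t) :
    doubleWronskian a (phi A Cp) (psi A Cm) t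
      = (krylov a ((-1 / 2 : ℂ) • A) (phi A Cp t) (psi A Cm t)).det := by
  rw [doubleWronskian]
  congr 1
  ext i j
  have h1 : -((-1 / 2 : ℂ) • A) = (1 / 2 : ℂ) • A := by
    rw [← neg_smul]; norm_num
  have h2 : (1 / 2 : ℂ) • (-A) = (-1 / 2 : ℂ) • A := by
    rw [smul_neg, ← neg_smul]; norm_num
  simp only [krylov, Matrix.of_apply, psi_eq_phi, dx_phi _ _ ht, h1, h2]

/-- The Darboux matrix of the double Wronskian solution at the time vector `t`. -/
def darbouxAt (t : Times) : M2⟦X⟧ := darboux ((-1 / 2 : ℂ) • A) (phi A Cp t) (psi A Cm t)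

lemma coeff_zero_darbouxAt (t : Times) : coeff 0 (darbouxAt A Cp Cm t) = 1 :=
  coeff_zero_darboux _ _ _

/-- Nonvanishing of `f` is not required: with division by zero equal to zero, both sides vanish
where `f` does. -/
lemma qsol_eq {t : Times} (ht : Admissible t) :
    qsol n (phi A Cp) (psi A Cm) t = -2 * coeff 1 (darbouxAt A Cp Cm t) 0 1 := by
  rw [qsol, wf, doubleWronskian_eq_det_krylov A Cp Cm _ ht,
    doubleWronskian_eq_det_krylov A Cp Cm _ ht, darbouxAt, coeff_one_darboux]
  ring

/-- The constant `4ˡ` compensates `(-1/2)^{2l+1} = -(1/2)·4⁻ˡ` in the power of `B = -A/2`. -/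
lemma hasDerivSeries_darbouxAt {t : Times} (ht : Admissible t) (l : ℕ) {s : ℂ}
    (h : wf n (phi A Cp) (psi A Cm) (update t l s) ≠ 0) :
    HasDerivSeries (fun z => darbouxAt A Cp Cm (update t l z))
      (-(C ((4 ^ l : ℂ) • (1 : M2)) * (X * (tail (2 * l + 2)
        (resolvent (darbouxAt A Cp Cm (update t l s))) * darbouxAt A Cp Cm (update t l s))))) s := by
  have hB : ((-1 / 2 : ℂ) • A) ^ (2 * l + 1) = (-(1 / 2) * (4 ^ l : ℂ)⁻¹) • A ^ (2 * l + 1) := by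
    rw [smul_pow]
    congr 1
    rw [pow_succ, pow_mul, ← inv_pow]
    norm_num
    ring
  have h4 : (4 : ℂ) ^ l ≠ 0 := pow_ne_zero _ (by norm_num)
  refine hasDerivSeries_darboux (m := 2 * l + 1) (fun i => ?_) (fun i => ?_) ?_
  · convert! hasDerivAt_phi A Cp ht l s i using 1
    rw [hB, Matrix.smul_mulVec, Matrix.smul_mulVec, Pi.smul_apply, Pi.smul_apply, smul_eq_mul,
      smul_eq_mul]
    field_simp
  · rw [psi_eq_phi]
    convert! hasDerivAt_phi (-A) Cm ht l s i using 1
    rw [hB, Odd.neg_pow ⟨l, rfl⟩, Matrix.smul_mulVec, Matrix.smul_mulVec, Matrix.neg_mulVec,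
      Pi.smul_apply, Pi.smul_apply, Pi.neg_apply, smul_eq_mul, smul_eq_mul]
    field_simp
  · rwa [wf, doubleWronskian_eq_det_krylov A Cp Cm _ (admissible_update ht l s)] at h

/-- The double Wronskian quotients solve the odd AKNS flows, with `r` read off from the
Darboux matrix. -/
theorem hasDerivAt_qsol {r : Times → ℂ} {t : Times} (ht : Admissible t)
    (hf : wf n (phi A Cp) (psi A Cm) t ≠ 0)
    (hr : ∀ t, Admissible t → wf n (phi A Cp) (psi A Cm) t ≠ 0 →
      r t = 2 * coeff 1 (darbouxAt A Cp Cm t) 1 0) :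
    AnalyticAt ℂ (line (qsol n (phi A Cp) (psi A Cm)) t 0) (t 0) ∧
    AnalyticAt ℂ (line r t 0) (t 0) ∧
    ∀ l : ℕ, HasDerivAt (line (qsol n (phi A Cp) (psi A Cm)) t l)
      (evalAt (K (2 * l + 1)).1 (qsol n (phi A Cp) (psi A Cm)) r t) (t l) := by
  set q := qsol n (phi A Cp) (psi A Cm) with hq
  set P : ℂ → M2⟦X⟧ := fun z => darbouxAt A Cp Cm (update t 0 z) with hPdef
  set O : Set ℂ := {z | wf n (phi A Cp) (psi A Cm) (update t 0 z) ≠ 0} with hOdef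
  have hadm := fun z => admissible_update ht 0 z
  have hO : IsOpen O := by
    have hc : Continuous fun z => wf n (phi A Cp) (psi A Cm) (update t 0 z) := by
      simp only [wf, doubleWronskian_eq_det_krylov A Cp Cm _ (hadm _)]
      refine continuous_iff_continuousAt.mpr fun s => DifferentiableAt.continuousAt (𝕜 := ℂ)
        (differentiableAt_det (differentiableAt_krylov (n + 1) _ (fun i => ?_) fun i => ?_))
      · exact (hasDerivAt_phi A Cp ht 0 s i).differentiableAt
      · rw [psi_eq_phi]
        exact (hasDerivAt_phi (-A) Cm ht 0 s i).differentiableAt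
    exact isOpen_ne.preimage hc
  have hP : ∀ s ∈ O, HasDerivSeries P (-(X * (tail 2 (resolvent (P s)) * P s))) s := by
    intro s hs
    have := hasDerivSeries_darbouxAt A Cp Cm ht 0 hs
    simpa using this
  have hql : ∀ s, line q t 0 s = -2 * coeff 1 (P s) 0 1 := fun s => qsol_eq A Cp Cm (hadm s)
  have hrl : ∀ s ∈ O, line r t 0 s = 2 * coeff 1 (P s) 1 0 := fun s hs => hr _ (hadm s) hs
  -- Complex differentiability on an open set gives analyticity, hence all the derivatives that
  -- enter differential polynomials.
  have hqa : ∀ s ∈ O, AnalyticAt ℂ (line q t 0) s := by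
    have : DifferentiableOn ℂ (line q t 0) O := fun s hs =>
      (DifferentiableAt.congr_of_eventuallyEq ((hP s hs 1 0 1).differentiableAt.const_mul (-2))
        (Eventually.of_forall hql)).differentiableWithinAt
    exact fun s hs => this.analyticAt (hO.mem_nhds hs)
  have hra : ∀ s ∈ O, AnalyticAt ℂ (line r t 0) s := by
    have : DifferentiableOn ℂ (line r t 0) O := fun s hs =>
      (DifferentiableAt.congr_of_eventuallyEq ((hP s hs 1 1 0).differentiableAt.const_mul 2)
        (by filter_upwards [hO.mem_nhds hs] with z hz using hrl z hz)).differentiableWithinAt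
    exact fun s hs => this.analyticAt (hO.mem_nhds hs)
  have htO : t 0 ∈ O := by rwa [hOdef, Set.mem_ofPred_eq, update_eq_self]
  have hV1 : ∀ s ∈ O, coeff 1 (resolvent (P s)) = !![0, line q t 0 s; line r t 0 s, 0] := by
    intro s hs
    rw [coeff_one_resolvent (coeff_zero_darbouxAt A Cp Cm _), hql, hrl s hs, commutator_sigma3]
  have habc := fun k => ev_abc hO (fun z => coeff_zero_darbouxAt A Cp Cm _) hP hqa hra hV1 k _ htO
  refine ⟨hqa _ htO, hra _ htO, fun l => ?_⟩
  have hl := hasDerivSeries_darbouxAt A Cp Cm ht l (s := t l) (by rwa [update_eq_self])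
  have h01 := (hl 1 0 1).const_mul (-2)
  rw [update_eq_self] at h01
  have hfun : line q t l = fun z => -2 * coeff 1 (darbouxAt A Cp Cm (update t l z)) 0 1 := by
    funext z
    exact qsol_eq A Cp Cm (admissible_update ht l z)
  rw [hfun]
  convert! h01 using 1
  -- Since `P₀ = 1`, only the first coefficient of the tail of `V` contributes in degree one.
  have hcoef : coeff 1 (C ((4 ^ l : ℂ) • (1 : M2)) * (X * (tail (2 * l + 2)
      (resolvent (darbouxAt A Cp Cm t)) * darbouxAt A Cp Cm t)))
      = (4 ^ l : ℂ) • coeff (2 * l + 2) (resolvent (darbouxAt A Cp Cm t)) := by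
    have := coeff_succ_X_mul 0 (tail (2 * l + 2) (resolvent (darbouxAt A Cp Cm t)) * darbouxAt A Cp Cm t)
    rw [zero_add] at this
    rw [coeff_C_mul, this, coeff_mul, Finset.Nat.antidiagonal_zero, Finset.sum_singleton,
      coeff_zero_darbouxAt, mul_one, tail, coeff_mk, zero_add, Matrix.smul_mul, one_mul]
  have h2 := habc (2 * l + 2)
  rw [update_eq_self] at h2
  rw [map_neg, hcoef, h2, K_eq]
  have hev : ∀ p, evalAt p q r t = ev (line q t 0) (line r t 0) (t 0) p := fun p => rfl
  rw [hev]
  simp only [map_mul, map_pow, map_neg, map_ofNat, pow_succ, pow_mul]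
  simp
  ring

end solution

/-! ### The reflection of the times -/

section reflection

variable {N n : ℕ} {σ δ : ℂ}

lemma reflect_reflect (hσ : σ * σ = 1) (t : Times) : reflect σ σ (reflect σ σ t) = t := by
  funext j
  by_cases hj : j = 0
  · subst hj; simp [reflect, ← mul_assoc, hσ]
  · simp [reflect, hj, ← mul_assoc, hσ]

/-- The relation `ψ(x, t) = T φ(σ x, σ t)`. -/
lemma psi_eq_mulVec_phi_reflect (hσ : σ * σ = 1) {A T : Matrix (Fin N) (Fin N) ℂ}
    (hAT : A * T + σ • (T * A) = 0) (Cp : Fin N → ℂ) {t : Times} (ht : Admissible t) :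
    psi A (T *ᵥ Cp) t = T *ᵥ phi A Cp (reflect σ σ t) := by
  -- As `-A` and `σA` are intertwined by `T` and `σ` is its own odd power, the phase of `-A` at `t`
  -- matches the phase of `A` with all times multiplied by `σ`.
  have hAT' : -A * T = σ • (T * A) := by
    rw [Matrix.neg_mul]; exact neg_eq_of_add_eq_zero_right hAT
  have hpow : ∀ k, (-A) ^ k * T = σ ^ k • (T * A ^ k) := by
    intro k
    induction k with
    | zero => simp
    | succ k ih =>
      rw [pow_succ, Matrix.mul_assoc, hAT', Matrix.mul_smul, ← Matrix.mul_assoc, ih,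
        Matrix.smul_mul, smul_smul, Matrix.mul_assoc, ← pow_succ, ← pow_succ']
  have hphase : phase (-A) t * T = T * phase A (reflect σ σ t) := by
    refine phase_mul_eq_mul_phase ht (admissible_reflect ht σ) fun j => ?_
    have h1 : σ ^ (2 * j + 1) = σ := by rw [pow_succ, pow_mul, pow_two, hσ, one_pow, one_mul]
    have h2 : reflect σ σ t j = σ * t j := by
      by_cases hj : j = 0
      · subst hj; simp [reflect]
      · simp [reflect, hj]
    rw [Matrix.smul_mul, Matrix.mul_smul, hpow, h1, h2, smul_smul, mul_comm]
  rw [psi_eq_phi, phi, phi, Matrix.mulVec_mulVec, Matrix.mulVec_mulVec, exp_mul_eq_mul_exp hphase]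

variable {A T : Matrix (Fin (n + 1 + (n + 1))) (Fin (n + 1 + (n + 1))) ℂ}
  {Cp : Fin (n + 1 + (n + 1)) → ℂ}

/-- The double Wronskian solutions of the mKdV hierarchy. -/
theorem solvesMKdV_qsol (hσ : σ * σ = 1) (hδ : δ * δ = 1) (hAT : A * T + σ • (T * A) = 0)
    (hT : T * T = (δ * σ) • 1) :
    SolvesMKdV σ σ δ (qsol n (phi A Cp) (psi A (T *ᵥ Cp))) (regular n (phi A Cp) (psi A (T *ᵥ Cp))) := by
  have hδσ : (δ * σ) * (δ * σ) = 1 := by linear_combination δ * δ * hσ + hδ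
  set B : Matrix (Fin (n + 1 + (n + 1))) (Fin (n + 1 + (n + 1))) ℂ := (-1 / 2 : ℂ) • A with hB
  have hBT : T * B = (-σ) • (B * T) := by
    have h1 : A * T = -(σ • (T * A)) := eq_neg_of_add_eq_zero_left hAT
    rw [hB, Matrix.mul_smul, Matrix.smul_mul, h1, smul_neg, smul_neg, neg_smul, neg_neg, smul_smul,
      smul_smul, show σ * (-1 / 2) * σ = (-1 / 2) * (σ * σ) by ring, hσ, mul_one]
  have hψ : ∀ t, Admissible t → psi A (T *ᵥ Cp) t = T *ᵥ phi A Cp (reflect σ σ t) :=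
    fun t ht => psi_eq_mulVec_phi_reflect hσ hAT Cp ht
  have hψ' : ∀ t, Admissible t → psi A (T *ᵥ Cp) (reflect σ σ t) = T *ᵥ phi A Cp t := fun t ht => by
    rw [hψ _ (admissible_reflect ht σ), reflect_reflect hσ]
  have hφ' : ∀ t, Admissible t →
      phi A Cp (reflect σ σ t) = (δ * σ) • (T *ᵥ psi A (T *ᵥ Cp) t) := fun t ht => by
    rw [hψ t ht, Matrix.mulVec_mulVec, hT, Matrix.smul_mulVec, smul_smul, hδσ, one_smul,
      Matrix.one_mulVec]
  have hinv : ∀ t, Admissible t → wf n (phi A Cp) (psi A (T *ᵥ Cp)) t ≠ 0 →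
      wf n (phi A Cp) (psi A (T *ᵥ Cp)) (reflect σ σ t) ≠ 0 := by
    intro t ht h
    rw [wf, doubleWronskian_eq_det_krylov _ _ _ _ ht] at h
    rw [wf, doubleWronskian_eq_det_krylov _ _ _ _ (admissible_reflect ht σ)]
    -- A solution of the homogeneous system at the reflected times is twisted into one at `t`, hence
    -- vanishes; the twist is invertible.
    refine det_krylov_ne_zero fun S hS k hk => ?_
    rw [hφ' t ht, hψ' t ht] at hS
    have h0 := coeff_eq_zero_of_wsum_eq_zero h _ (wsum_twist_eq_zero hBT hT hδσ hS) k hk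
    have hJ : (!![0, -1; -(δ * σ), 0] : M2) * !![0, -(δ * σ); -1, 0] = 1 := by
      ext i j
      fin_cases i <;> fin_cases j <;> simp [Matrix.mul_apply, Fin.sum_univ_two, hδσ]
    have hJ' := mul_eq_one_comm.mp hJ
    rw [twist, coeff_mk] at h0
    have h1 : (!![0, -(δ * σ); -1, 0] * coeff k S * !![0, -1; -(δ * σ), 0] : M2) = 0 := by
      refine (smul_eq_zero.mp h0).resolve_left (pow_ne_zero _ (neg_ne_zero.mpr ?_))
      exact left_ne_zero_of_mul_eq_one hσ
    calc coeff k S = (!![0, -1; -(δ * σ), 0] * !![0, -(δ * σ); -1, 0]) * coeff k S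
          * (!![0, -1; -(δ * σ), 0] * !![0, -(δ * σ); -1, 0]) := by rw [hJ, one_mul, mul_one]
      _ = !![0, -1; -(δ * σ), 0] * (!![0, -(δ * σ); -1, 0] * coeff k S * !![0, -1; -(δ * σ), 0])
          * !![0, -(δ * σ); -1, 0] := by simp only [mul_assoc]
      _ = 0 := by rw [h1, mul_zero, zero_mul]
  have hr : ∀ t, Admissible t → wf n (phi A Cp) (psi A (T *ᵥ Cp)) t ≠ 0 →
      δ * qsol n (phi A Cp) (psi A (T *ᵥ Cp)) (reflect σ σ t)
        = 2 * coeff 1 (darbouxAt A Cp (T *ᵥ Cp) t) 1 0 := by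
    intro t ht h
    have ht' := admissible_reflect ht σ
    have h' := hinv t ht h
    rw [qsol_eq _ _ _ ht']
    rw [wf, doubleWronskian_eq_det_krylov _ _ _ _ ht] at h
    rw [wf, doubleWronskian_eq_det_krylov _ _ _ _ ht'] at h'
    have hw := wsum_darboux h'
    set F := darbouxAt A Cp (T *ᵥ Cp) (reflect σ σ t) with hF
    have hw' : wsum B (pairMat (phi A Cp (reflect σ σ t)) (psi A (T *ᵥ Cp) (reflect σ σ t))) (n + 1) F
      = 0 := hw
    rw [hφ' t ht, hψ' t ht] at hw'
    -- By uniqueness the twisted Darboux matrix of the reflected times is the Darboux matrix at `t`;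
    -- its lower left `X`-coefficient gives `r`.
    have h1 := coeff_eq_coeff_darboux h (twist_coeff_zero hδσ (coeff_zero_darbouxAt A Cp _ _))
      (wsum_twist_eq_zero hBT hT hδσ hw') (k := 1) (by omega)
    rw [darbouxAt, ← hB, ← h1, twist, coeff_mk]
    simp only [Matrix.smul_apply, Matrix.mul_apply, Fin.sum_univ_two, smul_eq_mul]
    simp
    linear_combination (-2 * δ * coeff 1 F 0 1) * hσ
  intro t ht
  obtain ⟨h1, h2, h3⟩ := hasDerivAt_qsol A Cp (T *ᵥ Cp) ht.1 ht.2 hr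
  exact ⟨⟨admissible_reflect ht.1 σ, hinv t ht.1 ht.2⟩, h1, h2, h3⟩

end reflection

/-! ### Independence of the values at inadmissible times. -/

section congruence

variable {n : ℕ} {σ δ : ℂ}

lemma doubleWronskian_congr {N : ℕ} {φ φ' ψ ψ' : Times → Fin N → ℂ}
    (hφ : ∀ t, Admissible t → φ t = φ' t) (hψ : ∀ t, Admissible t → ψ t = ψ' t) (a : ℕ)
    {t : Times} (ht : Admissible t) : doubleWronskian a φ ψ t = doubleWronskian a φ' ψ' t := by
  rw [doubleWronskian, doubleWronskian]
  congr 1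
  ext i j
  have h1 : line (fun s => φ s i) t 0 = line (fun s => φ' s i) t 0 := by
    funext z; simp only [line, hφ _ (admissible_update ht 0 z)]
  have h2 : line (fun s => ψ s i) t 0 = line (fun s => ψ' s i) t 0 := by
    funext z; simp only [line, hψ _ (admissible_update ht 0 z)]
  simp only [Matrix.of_apply, dx, h1, h2]

/-- Being a solution only depends on the admissible times. -/
lemma SolvesMKdV.congr {φ φ' ψ ψ' : Times → Fin (n + 1 + (n + 1)) → ℂ}
    (hφ : ∀ t, Admissible t → φ t = φ' t) (hψ : ∀ t, Admissible t → ψ t = ψ' t)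
    (h : SolvesMKdV σ σ δ (qsol n φ ψ) (regular n φ ψ)) :
    SolvesMKdV σ σ δ (qsol n φ' ψ') (regular n φ' ψ') := by
  have hw : ∀ t, Admissible t → wf n φ ψ t = wf n φ' ψ' t := fun t ht =>
    doubleWronskian_congr hφ hψ _ ht
  have hq : ∀ t, Admissible t → qsol n φ ψ t = qsol n φ' ψ' t := fun t ht => by
    rw [qsol, qsol, hw t ht, doubleWronskian_congr hφ hψ _ ht]
  have hreg : regular n φ ψ = regular n φ' ψ' := by
    ext t
    exact and_congr_right fun ht => by rw [hw t ht]
  have hql : ∀ t, Admissible t → ∀ l, line (qsol n φ ψ) t l = line (qsol n φ' ψ') t l := by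
    intro t ht l
    funext z
    exact hq _ (admissible_update ht l z)
  have hrl : ∀ t, Admissible t → line (fun s => δ * qsol n φ ψ (reflect σ σ s)) t 0
      = line (fun s => δ * qsol n φ' ψ' (reflect σ σ s)) t 0 := by
    intro t ht
    funext z
    simp only [line, hq _ (admissible_reflect (admissible_update ht 0 z) σ)]
  rw [← hreg]
  intro t ht
  obtain ⟨h1, h2, h3, h4⟩ := h t ht
  have hev : ∀ p, evalAt p (qsol n φ' ψ') (fun s => δ * qsol n φ' ψ' (reflect σ σ s)) t
      = evalAt p (qsol n φ ψ) (fun s => δ * qsol n φ ψ (reflect σ σ s)) t := fun p => by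
    simp only [evalAt, dx, hql t ht.1 0, hrl t ht.1]
  refine ⟨h1, ?_, ?_, fun l => ?_⟩
  · rwa [← hql t ht.1 0]
  · rwa [← hrl t ht.1]
  · rw [← hql t ht.1 l, hev]
    exact h4 l

end congruence

/-! ### Explicit forms of `φ` -/

section xi

lemma xi_eq (k : ℂ) {t : Times} (ht : Admissible t) :
    xi k t = ∑' j, 1 / 2 * (k ^ (2 * j + 1) * t j) := by
  rw [tsum_mul_left, (ht k).tsum_eq_zero_add, xi]
  simp
  ring

lemma xi_neg (k : ℂ) {t : Times} (ht : Admissible t) : xi (-k) t = -xi k t := by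
  rw [xi_eq _ ht, xi_eq _ ht, ← tsum_neg]
  refine tsum_congr fun j => ?_
  rw [Odd.neg_pow ⟨j, rfl⟩]
  ring

lemma norm_xi_term_le {t : Times} {R : ℝ} {z : ℂ} (hz : z ∈ Metric.ball (0 : ℂ) R) (j : ℕ) :
    ‖1 / 2 * (z ^ (2 * j + 1) * t j)‖ ≤ ‖1 / 2 * ((R : ℂ) ^ (2 * j + 1) * t j)‖ := by
  have h1 : ‖z‖ ≤ ‖(R : ℂ)‖ := by
    rw [Complex.norm_real]
    exact (mem_ball_zero_iff.mp hz).le.trans (le_abs_self R)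
  simp only [norm_mul, norm_pow]
  gcongr

lemma summable_norm_xi_term {t : Times} (ht : Admissible t) (R : ℝ) :
    Summable fun j => ‖1 / 2 * ((R : ℂ) ^ (2 * j + 1) * t j)‖ :=
  ((ht R).mul_left _).norm

/-- The terms at `|z| < R` are dominated by those at `z = R`, so the series converges normally on
every disc. -/
lemma differentiable_xi {t : Times} (ht : Admissible t) : Differentiable ℂ fun z => xi z t := by
  intro z
  simp only [xi_eq _ ht]
  have hz : z ∈ Metric.ball (0 : ℂ) (‖z‖ + 1) := by simp
  exact (Complex.differentiableOn_tsum_of_summable_norm (summable_norm_xi_term ht (‖z‖ + 1))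
    (fun j => by fun_prop) Metric.isOpen_ball fun j w hw => norm_xi_term_le hw j).differentiableAt
    (Metric.isOpen_ball.mem_nhds hz)

end xi

section diagonal

lemma phi_diagonal {m : ℕ} (k c : Fin m → ℂ) {t : Times} (ht : Admissible t) :
    phi (Matrix.diagonal k) c t = fun i => c i * Complex.exp (xi (k i) t) := by
  have h : phase (Matrix.diagonal k) t = Matrix.diagonal fun i => xi (k i) t := by
    have hs : ∀ j, t j • (Matrix.diagonal k) ^ (2 * j + 1)
        = Matrix.diagonal fun i => k i ^ (2 * j + 1) * t j := by
      intro j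
      rw [Matrix.diagonal_pow, ← Matrix.diagonal_smul]
      congr 1
      funext i
      simp [mul_comm]
    simp only [phase, hs]
    rw [← Matrix.diagonal_tsum, ← Matrix.diagonal_smul]
    congr 1
    funext i
    rw [Pi.smul_apply, smul_eq_mul, xi_eq _ ht, tsum_mul_left, tsum_apply]
    exact Pi.summable.mpr fun i => ht (k i)
  rw [phi, h, Matrix.exp_diagonal]
  funext i
  rw [Matrix.mulVec_diagonal, mul_comm, Pi.coe_exp, ← Complex.exp_eq_exp_ℂ]

end diagonal

/-! ### Functional calculus of Jordan blocks on Taylor vectors. -/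

section jordan

variable {m : ℕ} {k : ℂ}

/-- The Toeplitz matrix of multiplication by `h` on Taylor coefficients at `k`. -/
def toeplitz (m : ℕ) (h : ℂ → ℂ) (k : ℂ) : Matrix (Fin m) (Fin m) ℂ :=
  Matrix.of fun i j => if (j : ℕ) ≤ i then iteratedDeriv (i - j) h k / (Nat.factorial (i - j) : ℂ)
    else 0

/-- The Leibniz rule, divided by `i!`, is the Cauchy product of Taylor coefficients. -/
lemma taylorVec_mul {h g : ℂ → ℂ} (hh : AnalyticAt ℂ h k) (hg : AnalyticAt ℂ g k) :
    taylorVec m (fun z => h z * g z) k = toeplitz m h k *ᵥ taylorVec m g k := by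
  funext i
  have h1 : (fun z => h z * g z) = g * h := by funext z; simp [mul_comm]
  rw [taylorVec, h1, iteratedDeriv_mul hg.contDiffAt hh.contDiffAt]
  simp only [toeplitz, Matrix.mulVec, dotProduct, Matrix.of_apply, taylorVec, ite_mul, zero_mul]
  rw [Fin.sum_univ_eq_sum_range (fun j => if j ≤ (i : ℕ) then iteratedDeriv (i - j) h k
    / (Nat.factorial (i - j) : ℂ) * (iteratedDeriv j g k / (Nat.factorial j : ℂ)) else 0) m,
    ← Finset.sum_filter]
  have h2 : (Finset.range m).filter (fun j => j ≤ (i : ℕ)) = Finset.range (i + 1) := by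
    ext j
    simp only [Finset.mem_filter, Finset.mem_range]
    have := i.2
    omega
  rw [h2, Finset.sum_div]
  refine Finset.sum_congr rfl fun j hj => ?_
  have hj' : j ≤ i := Nat.lt_succ_iff.mp (Finset.mem_range.mp hj)
  have hc : ((Nat.choose i j : ℂ)) * (Nat.factorial j) * (Nat.factorial (i - j))
      = Nat.factorial i := by exact_mod_cast Nat.choose_mul_factorial_mul_factorial hj'
  have n1 : (Nat.factorial j : ℂ) ≠ 0 := Nat.cast_ne_zero.mpr (Nat.factorial_ne_zero _)
  have n2 : (Nat.factorial (i - j) : ℂ) ≠ 0 := Nat.cast_ne_zero.mpr (Nat.factorial_ne_zero _)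
  have n3 : (Nat.factorial i : ℂ) ≠ 0 := Nat.cast_ne_zero.mpr (Nat.factorial_ne_zero _)
  rw [div_mul_div_comm, div_eq_div_iff n3 (mul_ne_zero n2 n1), ← hc]
  ring

/-- Identifies the Jordan block with multiplication by the variable, whose Taylor coefficients at
`k` are `k, 1, 0, …`. -/
lemma toeplitz_id : toeplitz m (fun z => z) k = jordan m k := by
  ext i j
  simp only [toeplitz, jordan, Matrix.of_apply]
  have hid : ∀ e : ℕ, iteratedDeriv e (fun z : ℂ => z) k = if e = 0 then k else if e = 1 then 1 else 0 := by
    intro e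
    rcases e with _ | _ | e
    · simp
    · simp [iteratedDeriv_one]
    · rw [iteratedDeriv_succ']
      simp [iteratedDeriv_const]
  rw [hid]
  rcases lt_trichotomy (i : ℕ) j with h | h | h
  · have h1 : i ≠ j := fun h' => by simp [h'] at h
    simp [h1, show ¬ ((j : ℕ) ≤ i) by omega, show ¬ ((i : ℕ) = j + 1) by omega]
  · obtain rfl : i = j := Fin.ext h
    simp
  · have h1 : i ≠ j := fun h' => by simp [h'] at h
    rw [if_pos h.le, if_neg (by omega), if_neg h1]
    by_cases h2 : (i : ℕ) = j + 1
    · rw [if_pos h2, if_pos (by omega), show (i : ℕ) - j = 1 by omega]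
      simp
    · rw [if_neg h2, if_neg (by omega), zero_div]

lemma taylorVec_const_mul (a : ℂ) (g : ℂ → ℂ) :
    taylorVec m (fun z => a * g z) k = a • taylorVec m g k := by
  funext i
  rw [taylorVec, iteratedDeriv_const_mul_field]
  simp [taylorVec, mul_div_assoc]

/-- Weierstrass: locally uniform limits of holomorphic functions may be differentiated repeatedly.
-/
lemma hasSum_iteratedDeriv {ι : Type*} {f : ι → ℂ → ℂ} {u : ι → ℝ} (hu : Summable u)
    (hf : ∀ i, Differentiable ℂ (f i)) {U : Set ℂ} (hU : IsOpen U)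
    (hle : ∀ i, ∀ z ∈ U, ‖f i z‖ ≤ u i) (hk : k ∈ U) (a : ℕ) :
    HasSum (fun i => iteratedDeriv a (f i) k) (iteratedDeriv a (fun z => ∑' i, f i z) k) := by
  have hF : ∀ s : Finset ι, Differentiable ℂ fun z => ∑ i ∈ s, f i z := fun s =>
    Differentiable.fun_sum fun i _ => hf i
  have h : ∀ a, TendstoLocallyUniformlyOn (fun (s : Finset ι) => iteratedDeriv a fun z => ∑ i ∈ s, f i z)
      (iteratedDeriv a fun z => ∑' i, f i z) atTop U := by
    intro a
    induction a with
    | zero =>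
      simp only [iteratedDeriv_zero]
      exact (tendstoUniformlyOn_tsum hu hle).tendstoLocallyUniformlyOn
    | succ a ih =>
      simp only [iteratedDeriv_succ]
      exact ih.deriv (Eventually.of_forall fun s =>
        ((hF s).contDiff (n := (a + 1 : ℕ))).differentiable_iteratedDeriv a
          (by exact_mod_cast Nat.lt_succ_self a) |>.differentiableOn) hU
  rw [HasSum]
  refine ((h a).tendsto_at hk).congr fun s => ?_
  exact iteratedDeriv_fun_sum fun i _ => (hf i).contDiff.contDiffAt

/-- Taylor vectors of products commute with normally convergent series. -/
lemma hasSum_taylorVec_mul {ι : Type*} {f : ι → ℂ → ℂ} {u : ι → ℝ} (hu : Summable u)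
    (hf : ∀ i, Differentiable ℂ (f i)) {U : Set ℂ} (hU : IsOpen U)
    (hle : ∀ i, ∀ z ∈ U, ‖f i z‖ ≤ u i) (hk : k ∈ U) {g : ℂ → ℂ} (hg : AnalyticAt ℂ g k) :
    HasSum (fun i => taylorVec m (fun z => f i z * g z) k)
      (taylorVec m (fun z => (∑' i, f i z) * g z) k) := by
  have hd : DifferentiableOn ℂ (fun z => ∑' i, f i z) U :=
    Complex.differentiableOn_tsum_of_summable_norm hu (fun i => (hf i).differentiableOn) hU hle
  rw [taylorVec_mul (hd.analyticAt (hU.mem_nhds hk)) hg]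
  have h1 : ∀ i, taylorVec m (fun z => f i z * g z) k = toeplitz m (f i) k *ᵥ taylorVec m g k :=
    fun i => taylorVec_mul ((hf i).analyticAt k) hg
  simp only [h1]
  refine Pi.hasSum.mpr fun x => ?_
  simp only [Matrix.mulVec, dotProduct]
  refine hasSum_sum fun y _ => HasSum.mul_right _ ?_
  simp only [toeplitz, Matrix.of_apply]
  split_ifs
  · exact (hasSum_iteratedDeriv hu hf hU hle hk _).div_const _
  · exact hasSum_zero

lemma taylorVec_pow_mul {h : ℂ → ℂ} (hh : Differentiable ℂ h) {H : Matrix (Fin m) (Fin m) ℂ}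
    (hH : ∀ g, AnalyticAt ℂ g k → taylorVec m (fun z => h z * g z) k = H *ᵥ taylorVec m g k)
    {g : ℂ → ℂ} (hg : AnalyticAt ℂ g k) (p : ℕ) :
    taylorVec m (fun z => h z ^ p * g z) k = H ^ p *ᵥ taylorVec m g k := by
  induction p with
  | zero => simp
  | succ p ih =>
    have ha : AnalyticAt ℂ (fun z => h z ^ p * g z) k := ((hh.analyticAt k).pow p).mul hg
    rw [pow_succ', ← Matrix.mulVec_mulVec, ← ih, ← hH _ ha]
    congr 1
    funext z
    ring

lemma taylorVec_xi_mul {t : Times} (ht : Admissible t) {g : ℂ → ℂ} (hg : AnalyticAt ℂ g k) :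
    taylorVec m (fun z => xi z t * g z) k = phase (jordan m k) t *ᵥ taylorVec m g k := by
  have hz : k ∈ Metric.ball (0 : ℂ) (‖k‖ + 1) := by simp
  have hid : ∀ g : ℂ → ℂ, AnalyticAt ℂ g k →
      taylorVec m (fun z => z * g z) k = jordan m k *ᵥ taylorVec m g k := fun g hg => by
    rw [← toeplitz_id]
    exact taylorVec_mul analyticAt_id hg
  have h1 := hasSum_taylorVec_mul (m := m) (summable_norm_xi_term ht (‖k‖ + 1))
    (f := fun j z => 1 / 2 * (z ^ (2 * j + 1) * t j)) (fun j => by fun_prop) Metric.isOpen_ball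
    (fun j w hw => norm_xi_term_le hw j) hz hg
  simp only [← xi_eq _ ht] at h1
  refine h1.unique ?_
  have h2 := ((summable_phase (jordan m k) ht).hasSum.const_smul (1 / 2 : ℂ)).map
    (AddMonoidHom.mk' (fun M : Matrix (Fin m) (Fin m) ℂ => M *ᵥ taylorVec m g k)
      fun a b => Matrix.add_mulVec a b _) (continuous_id.matrix_mulVec continuous_const)
  convert! h2 using 1
  funext j
  have h3 : (fun z => 1 / 2 * (z ^ (2 * j + 1) * t j) * g z)
      = fun z => (1 / 2 * t j) * (z ^ (2 * j + 1) * g z) := by funext z; ring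
  rw [h3, taylorVec_const_mul, taylorVec_pow_mul (h := fun z => z) differentiable_id hid hg]
  simp [Matrix.smul_mulVec, smul_smul]

/-- If `H` acts as multiplication by `h`, then `Hᵖ` acts as `hᵖ`, and the exponential series can be
summed on both sides. -/
lemma taylorVec_exp_mul {h : ℂ → ℂ} (hh : Differentiable ℂ h) {H : Matrix (Fin m) (Fin m) ℂ}
    (hH : ∀ g, AnalyticAt ℂ g k → taylorVec m (fun z => h z * g z) k = H *ᵥ taylorVec m g k)
    {g : ℂ → ℂ} (hg : AnalyticAt ℂ g k) :
    taylorVec m (fun z => g z * Complex.exp (h z)) k = NormedSpace.exp H *ᵥ taylorVec m g k := by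
  let _ : NormedRing (Matrix (Fin m) (Fin m) ℂ) := Matrix.linftyOpNormedRing
  let _ : NormedAlgebra ℂ (Matrix (Fin m) (Fin m) ℂ) := Matrix.linftyOpNormedAlgebra
  -- On this neighbourhood of `k` the exponential series of `h` is dominated by that of the constant
  -- `‖h k‖ + 1`.
  have hU : IsOpen {z | ‖h z‖ < ‖h k‖ + 1} := isOpen_lt hh.continuous.norm continuous_const
  have h1 := hasSum_taylorVec_mul (m := m) (Real.summable_pow_div_factorial (‖h k‖ + 1))
    (f := fun p z => h z ^ p / (Nat.factorial p : ℂ)) (fun p => (hh.pow p).div_const _) hU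
    (fun p z hz => by
      have hz' : ‖h z‖ ≤ ‖h k‖ + 1 := (show ‖h z‖ < ‖h k‖ + 1 from hz).le
      rw [norm_div, norm_pow, Complex.norm_natCast]
      gcongr) (show ‖h k‖ < ‖h k‖ + 1 from lt_add_one _) hg
  have hexp : (fun z => (∑' p : ℕ, h z ^ p / (Nat.factorial p : ℂ)) * g z)
      = fun z => g z * Complex.exp (h z) := by
    funext z
    rw [Complex.exp_eq_exp_ℂ, NormedSpace.exp_eq_tsum_div, mul_comm]
  rw [hexp] at h1
  refine h1.unique ?_
  have h2 := (NormedSpace.exp_series_hasSum_exp' (𝕂 := ℂ) H).map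
    (AddMonoidHom.mk' (fun M : Matrix (Fin m) (Fin m) ℂ => M *ᵥ taylorVec m g k)
      fun a b => Matrix.add_mulVec a b _) (continuous_id.matrix_mulVec continuous_const)
  convert! h2 using 1
  funext p
  have h3 : (fun z => h z ^ p / (Nat.factorial p : ℂ) * g z)
      = fun z => ((Nat.factorial p : ℂ)⁻¹) * (h z ^ p * g z) := by funext z; ring
  rw [h3, taylorVec_const_mul, taylorVec_pow_mul hh hH hg]
  simp [Matrix.smul_mulVec]

lemma phi_jordan {t : Times} (ht : Admissible t) {c : ℂ → ℂ} (hc : AnalyticAt ℂ c k) :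
    phi (jordan m k) (taylorVec m c k) t
      = taylorVec m (fun z => c z * Complex.exp (xi z t)) k :=
  (taylorVec_exp_mul (differentiable_xi ht) (fun _ hg => taylorVec_xi_mul ht hg) hc).symm

lemma phi_neg_jordan {t : Times} (ht : Admissible t) {d : ℂ → ℂ} (hd : AnalyticAt ℂ d k) :
    phi (-jordan m k) (taylorVec m d k) t
      = taylorVec m (fun z => d z * Complex.exp (xi (-z) t)) k := by
  simp only [xi_neg _ ht]
  rw [phi, phase_neg]
  refine (taylorVec_exp_mul (differentiable_xi ht).neg (fun g hg => ?_) hd).symm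
  have := taylorVec_const_mul (m := m) (k := k) (-1) fun z => xi z t * g z
  rw [taylorVec_xi_mul ht hg, neg_one_smul, ← Matrix.neg_mulVec] at this
  rw [← this]
  congr 1
  funext z
  simp

end jordan

/-! ### The explicit matrices `T` and `A` -/

section blocks

variable {m : ℕ}

lemma block_mul (a b c d a' b' c' d' : Matrix (Fin m) (Fin m) ℂ) :
    block a b c d * block a' b' c' d'
      = block (a * a' + b * c') (a * b' + b * d') (c * a' + d * c') (c * b' + d * d') := by
  simp only [block, Matrix.reindex_apply, Matrix.submatrix_mul_equiv, Matrix.fromBlocks_multiply]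

lemma block_add (a b c d a' b' c' d' : Matrix (Fin m) (Fin m) ℂ) :
    block a b c d + block a' b' c' d' = block (a + a') (b + b') (c + c') (d + d') := by
  simp only [block, Matrix.reindex_apply, ← Matrix.fromBlocks_add]
  rfl

lemma block_smul (s : ℂ) (a b c d : Matrix (Fin m) (Fin m) ℂ) :
    s • block a b c d = block (s • a) (s • b) (s • c) (s • d) := by
  simp only [block, Matrix.reindex_apply, ← Matrix.fromBlocks_smul]
  rfl

lemma block_one : block 1 0 0 1 = (1 : Matrix (Fin (m + m)) (Fin (m + m)) ℂ) := by
  simp [block, Matrix.fromBlocks_one]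

lemma block_zero : block 0 0 0 0 = (0 : Matrix (Fin (m + m)) (Fin (m + m)) ℂ) := by
  simp [block]

lemma tableA_mul_add {σ δ : ℂ} {T : Matrix (Fin (m + m)) (Fin (m + m)) ℂ} (hT : IsTableT σ δ T)
    (M : Matrix (Fin m) (Fin m) ℂ) : tableA M * T + σ • (T * tableA M) = 0 := by
  rw [← block_zero]
  rcases hT with ⟨rfl, rfl, rfl⟩ | ⟨rfl, rfl, rfl⟩ | ⟨rfl, rfl, rfl⟩ | ⟨rfl, rfl, rfl⟩ <;>
    simp only [tableA, block_mul, block_smul, block_add] <;> congr 1 <;> simp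

lemma IsTableT.mul_self {σ δ : ℂ} {T : Matrix (Fin (m + m)) (Fin (m + m)) ℂ}
    (hT : IsTableT σ δ T) : T * T = (δ * σ) • 1 := by
  rw [← block_one]
  rcases hT with ⟨rfl, rfl, rfl⟩ | ⟨rfl, rfl, rfl⟩ | ⟨rfl, rfl, rfl⟩ | ⟨rfl, rfl, rfl⟩ <;>
    simp only [block_mul, block_smul] <;> congr 1 <;> simp [smul_smul]

lemma phi_mulVec {N : ℕ} {A : Matrix (Fin N) (Fin N) ℂ} {A' : Matrix (Fin m) (Fin m) ℂ}
    {Y : Matrix (Fin N) (Fin m) ℂ} (h : A * Y = Y * A') (c : Fin m → ℂ) {t : Times}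
    (ht : Admissible t) : phi A (Y *ᵥ c) t = Y *ᵥ phi A' c t := by
  have hpow : ∀ k, A ^ k * Y = Y * A' ^ k := by
    intro k
    induction k with
    | zero => simp
    | succ k ih => rw [pow_succ, Matrix.mul_assoc, h, ← Matrix.mul_assoc, ih, Matrix.mul_assoc,
        ← pow_succ]
  rw [phi, phi, Matrix.mulVec_mulVec, Matrix.mulVec_mulVec,
    exp_mul_eq_mul_exp (phase_mul_eq_mul_phase ht ht fun j => ?_)]
  rw [Matrix.smul_mul, Matrix.mul_smul, hpow]

/-- The inclusion of the first summand. -/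
def inclLeft (m : ℕ) : Matrix (Fin (m + m)) (Fin m) ℂ :=
  Matrix.of fun i j => Fin.append (fun i => (1 : Matrix (Fin m) (Fin m) ℂ) i j) 0 i

/-- The inclusion of the second summand. -/
def inclRight (m : ℕ) : Matrix (Fin (m + m)) (Fin m) ℂ :=
  Matrix.of fun i j => Fin.append 0 (fun i => (1 : Matrix (Fin m) (Fin m) ℂ) i j) i

lemma append_eq (c d : Fin m → ℂ) :
    Fin.append c d = inclLeft m *ᵥ c + inclRight m *ᵥ d := by
  funext i
  refine Fin.addCases (fun i => ?_) (fun i => ?_) i <;>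
    simp [inclLeft, inclRight, Matrix.mulVec, dotProduct, Matrix.one_apply, -Fin.natAdd_eq_addNat]

lemma tableA_mul_inclLeft (M : Matrix (Fin m) (Fin m) ℂ) :
    tableA M * inclLeft m = inclLeft m * M := by
  ext i j
  refine Fin.addCases (fun i => ?_) (fun i => ?_) i <;>
    simp [tableA, block, inclLeft, Matrix.mul_apply, Fin.sum_univ_add, Matrix.one_apply, -Fin.natAdd_eq_addNat]

lemma tableA_mul_inclRight (M : Matrix (Fin m) (Fin m) ℂ) :
    tableA M * inclRight m = inclRight m * -M := by
  ext i j
  refine Fin.addCases (fun i => ?_) (fun i => ?_) i <;>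
    simp [tableA, block, inclRight, Matrix.mul_apply, Fin.sum_univ_add, Matrix.one_apply, -Fin.natAdd_eq_addNat]

/-- Each block inclusion intertwines `diag(M, -M)` with its block, so no block exponential has to be
computed. -/
lemma phi_tableA (M : Matrix (Fin m) (Fin m) ℂ) (c d : Fin m → ℂ) {t : Times} (ht : Admissible t) :
    phi (tableA M) (Fin.append c d) t = Fin.append (phi M c t) (phi (-M) d t) := by
  rw [append_eq, append_eq, ← phi_mulVec (tableA_mul_inclLeft M) c ht,
    ← phi_mulVec (tableA_mul_inclRight M) d ht, phi, phi, phi, Matrix.mulVec_add]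

lemma phi_tableA_diagonal (k c d : Fin m → ℂ) {t : Times} (ht : Admissible t) :
    phi (tableA (Matrix.diagonal k)) (Fin.append c d) t = phiDiag k c d t := by
  rw [phi_tableA _ _ _ ht, phiDiag, phi_diagonal _ _ ht, Matrix.diagonal_neg,
    phi_diagonal _ _ ht]

lemma phi_tableA_jordan (k : ℂ) {c d : ℂ → ℂ} (hc : AnalyticAt ℂ c k) (hd : AnalyticAt ℂ d k)
    {t : Times} (ht : Admissible t) :
    phi (tableA (jordan m k)) (Fin.append (taylorVec m c k) (taylorVec m d k)) t
      = phiJordan m k c d t := by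
  rw [phi_tableA _ _ _ ht, phiJordan, phi_jordan ht hc, phi_neg_jordan ht hd]

end blocks

/-- The solutions with explicit `φ` and `ψ(x, t) = T φ(σ x, σ t)`. -/
theorem solvesMKdV_explicit {n : ℕ} {σ δ : ℂ} (hσ : σ * σ = 1) (hδ : δ * δ = 1)
    {A T : Matrix (Fin (n + 1 + (n + 1))) (Fin (n + 1 + (n + 1))) ℂ}
    {Cp : Fin (n + 1 + (n + 1)) → ℂ} (hAT : A * T + σ • (T * A) = 0) (hT : T * T = (δ * σ) • 1)
    {φ : Times → Fin (n + 1 + (n + 1)) → ℂ} (hφ : ∀ t, Admissible t → phi A Cp t = φ t) :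
    SolvesMKdV σ σ δ (qsol n φ fun t => T *ᵥ φ (reflect σ σ t))
      (regular n φ fun t => T *ᵥ φ (reflect σ σ t)) := by
  -- The closed forms agree with `phi` only where the phase series converges, which suffices because
  -- time lines and the reflection preserve admissibility.
  refine SolvesMKdV.congr hφ (fun t ht => ?_) (solvesMKdV_qsol (Cp := Cp) hσ hδ hAT hT)
  rw [psi_eq_mulVec_phi_reflect hσ hAT Cp ht, hφ _ (admissible_reflect ht σ)]

end

end AKNS

theorem theorem4 (σ₁ σ₂ δ : ℂ) (hσ₁ : σ₁ = 1 ∨ σ₁ = -1) (hσ₂ : σ₂ = 1 ∨ σ₂ = -1)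
    (hδ : δ = 1 ∨ δ = -1) (hσ : σ₁ * σ₂ = 1) (n : ℕ) :
    -- the double Wronskian solutions
    (∀ (A T : Matrix (Fin (n + 1 + (n + 1))) (Fin (n + 1 + (n + 1))) ℂ)
        (Cp Cm : Fin (n + 1 + (n + 1)) → ℂ),
      A * T + σ₁ • (T * A) = 0 → T * T = (δ * σ₁) • 1 → Cm = T.mulVec Cp →
        (∀ t, AKNS.Admissible t →
          AKNS.psi A Cm t = T.mulVec (AKNS.phi A Cp (AKNS.reflect σ₁ σ₂ t))) ∧
        AKNS.SolvesMKdV σ₁ σ₂ δ (AKNS.qsol n (AKNS.phi A Cp) (AKNS.psi A Cm))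
          (AKNS.regular n (AKNS.phi A Cp) (AKNS.psi A Cm))) ∧
    -- the explicit matrices `T`, `A` and the explicit vectors `φ`
    (∀ T : Matrix (Fin (n + 1 + (n + 1))) (Fin (n + 1 + (n + 1))) ℂ, AKNS.IsTableT σ₁ δ T →
      (∀ M : Matrix (Fin (n + 1)) (Fin (n + 1)) ℂ,
        AKNS.tableA M * T + σ₁ • (T * AKNS.tableA M) = 0 ∧ T * T = (δ * σ₁) • 1) ∧
      (∀ k c d : Fin (n + 1) → ℂ,
        (∀ t, AKNS.Admissible t →
          AKNS.phi (AKNS.tableA (Matrix.diagonal k)) (Fin.append c d) t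
            = AKNS.phiDiag k c d t) ∧
        AKNS.SolvesMKdV σ₁ σ₂ δ
          (AKNS.qsol n (AKNS.phiDiag k c d)
            (fun t => T.mulVec (AKNS.phiDiag k c d (AKNS.reflect σ₁ σ₂ t))))
          (AKNS.regular n (AKNS.phiDiag k c d)
            (fun t => T.mulVec (AKNS.phiDiag k c d (AKNS.reflect σ₁ σ₂ t))))) ∧
      (∀ (k : ℂ) (c d : ℂ → ℂ), AnalyticAt ℂ c k → AnalyticAt ℂ d k →
        (∀ t, AKNS.Admissible t →
          AKNS.phi (AKNS.tableA (AKNS.jordan (n + 1) k))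
              (Fin.append (AKNS.taylorVec (n + 1) c k) (AKNS.taylorVec (n + 1) d k)) t
            = AKNS.phiJordan (n + 1) k c d t) ∧
        AKNS.SolvesMKdV σ₁ σ₂ δ
          (AKNS.qsol n (AKNS.phiJordan (n + 1) k c d)
            (fun t => T.mulVec (AKNS.phiJordan (n + 1) k c d (AKNS.reflect σ₁ σ₂ t))))
          (AKNS.regular n (AKNS.phiJordan (n + 1) k c d)
            (fun t => T.mulVec (AKNS.phiJordan (n + 1) k c d (AKNS.reflect σ₁ σ₂ t)))))) := by
  obtain rfl : σ₁ = σ₂ := by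
    rcases hσ₁ with rfl | rfl <;> rcases hσ₂ with rfl | rfl <;> first | rfl | norm_num at hσ
  have hδ' : δ * δ = 1 := by rcases hδ with rfl | rfl <;> norm_num
  refine ⟨fun A T Cp Cm hAT hT hC => ?_, fun T hT => ⟨fun M => ?_, fun k c d => ?_,
    fun k c d hc hd => ?_⟩⟩
  · subst hC
    exact ⟨fun t ht => AKNS.psi_eq_mulVec_phi_reflect hσ hAT Cp ht,
      AKNS.solvesMKdV_qsol hσ hδ' hAT hT⟩
  · exact ⟨AKNS.tableA_mul_add hT M, hT.mul_self⟩
  · exact ⟨fun t ht => AKNS.phi_tableA_diagonal k c d ht,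
      AKNS.solvesMKdV_explicit hσ hδ' (AKNS.tableA_mul_add hT _) hT.mul_self
        fun t ht => AKNS.phi_tableA_diagonal k c d ht⟩
  · exact ⟨fun t ht => AKNS.phi_tableA_jordan k hc hd ht,
      AKNS.solvesMKdV_explicit hσ hδ' (AKNS.tableA_mul_add hT _) hT.mul_self
        fun t ht => AKNS.phi_tableA_jordan k hc hd ht⟩
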